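/- Let $(X_t)_{t\ge 0}$ be a real Lévy process (with càdlàg paths) on a probability space $(\Omega,\mathcal F,\mathbb P)$ with characteristic triplet $(b,\sigma^2,\nu)$, i.e. $\mathbb E e^{iuX_t}=e^{t\psi(u)}$ with $$\psi(u)=iub-\tfrac12\sigma^2u^2+\int_{\mathbb R}\big(e^{iux}-1-iux1_{|x|\le 1}\big)\nu(dx).$$ Assume that the Lévy measure has a density $\nu(x)$ which is positive and $C^1$ on $\mathbb R\setminus\{0\}$, that $\sup_{|x|>\varepsilon}\nu(x)<\infty$ and $\sup_{|x|>\varepsilon}e^x\nu(x)<\infty$ for every $\varepsilon>0$, that $\int_{|x|>1}e^x\nu(x)\,dx<\infty$, and that $b+\frac12\sigma^2+\int_{\mathbb R}(e^x-1-x1_{|x|\le1})\nu(x)\,dx=0$. Let $(T_t)_{t\ge0}$ be a random clock independent of $X$, that is, a right-continuous nondecreasing $[0,\infty)$-valued process with $T_0=0$. Put $Z_t:=X_{T_t}$, $\widetilde{\mathcal F}_t:=\sigma(Z_u,T_u:u\le t)$ and $$\nu^*(x):=e^x\nu(x),\qquad b^*:=b+\int_{|x|\le1}x(e^x-1)\nu(x)\,dx+\sigma^2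 .$$ For each $t\ge0$ let $\widetilde{\mathbb P}_t(B):=\mathbb E(e^{Z_t}1_B)$, $B\in\mathcal F$. 1. Each $Z_t$ is measurable, each $\widetilde{\mathbb P}_t$ is a probability measure, and $\widetilde{\mathbb P}_t=\widetilde{\mathbb P}_s$ on $\widetilde{\mathcal F}_s\vee\mathcal N$ for $s\le t$, where $\mathcal N$ denotes the $\mathbb P$-null sets of $\mathcal F$. So $\widetilde{\mathbb P}(B):=\mathbb E(e^{Z_t}1_B)$ for $B\in\widetilde{\mathcal F}_t\vee\mathcal N$ does not depend on the choice of $t$. 2. On some probability space $(\Omega',\mathcal F',\mathbb P')$ there are a Lévy process $X^*$ with triplet $(b^*,\sigma^2,\nu^*)$ and a random clock $T^*$, independent of $X^*$ and with the same law as $T$ under $\mathbb P$. For any such $(\Omega',\mathcal F',\mathbb P',X^*,T^*)$ the following holds. For every $t\ge 0$ the process $(Z_u,T_u)_{u\le t}$ under $\widetilde{\mathbb P}_t$ has the same law as $(X^*_{T^*_u},T^*_u)_{u\le t}$ under $\mathbb P'$. Moreover, if $\widetilde{\mathbb P}$ is a measure on a $\sigma$-algebra containing all $\widetilde{\mathcal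 F}_t$ with $\widetilde{\mathbb P}(B)=\mathbb E(e^{Z_t}1_B)$ for all $t>0$ and $B\in\widetilde{\mathcal F}_t$, then $(Z_u,T_u)_{u\ge0}$ under $\widetilde{\mathbb P}$ has the same law as $(X^*_{T^*_u},T^*_u)_{u\ge0}$ under $\mathbb P'$. In particular, under $\widetilde{\mathbb P}$ the process $(Z_t)$ has the law of a Lévy process with triplet $(b^*,\sigma^2,\nu^*)$ evaluated at an independent random clock distributed as $(T_t)$. 3. For $S_0,K>0$, $k:=\log(K/S_0)$, $S_t:=S_0e^{Z_t}$ and every $t\ge0$, $(S_t-K)_+$ is integrable and $$\mathbb E(S_t-K)_+=S_0\,\widetilde{\mathbb P}_t(Z_t\ge k)-S_0e^k\,\mathbb P(Z_t\ge k).$$ -/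

import Mathlib

open MeasureTheory ProbabilityTheory Filter Topology
open scoped NNReal ENNReal

universe u v

noncomputable section

/-- The truncation function `x 1_{|x| ≤ 1}`. -/
def smallJump (x : ℝ) : ℝ := if |x| ≤ 1 then x else 0

/-- `ν` is a Lévy measure on `ℝ`: no mass at `0` and `∫ (1 ∧ x²) ν(dx) < ∞`. -/
structure IsLevyMeasure (ν : Measure ℝ) : Prop where
  zero : ν {0} = 0
  lintegral_lt_top : ∫⁻ x, ENNReal.ofReal (min 1 (x ^ 2)) ∂ν < ∞

/-- The Lévy-Khintchine exponent of the triplet `(b, a, ν)`, where `a` is the Gaussian variance. -/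
def levyExponent (b a : ℝ) (ν : Measure ℝ) (r : ℝ) : ℂ :=
  Complex.I * r * b - a * (r : ℂ) ^ 2 / 2
    + ∫ x : ℝ, (Complex.exp (Complex.I * r * x) - 1 - Complex.I * r * (smallJump x : ℂ)) ∂ν

/-- `X` is a real Lévy process under `P`: it starts at `0`, has independent and stationary
increments, and its paths are right-continuous with left limits. (Stochastic continuity
follows from the stationarity of the increments and the right-continuity of the paths.) -/
structure IsLevyProcess {Ω : Type*} [MeasurableSpace Ω] (X : ℝ≥0 → Ω → ℝ) (P : Measure Ω) :
    Prop where
  measurable : ∀ t, Measurable (X t)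
  zero : ∀ᵐ ω ∂P, X 0 ω = 0
  indep : HasIndepIncrements X P
  stationary : ∀ s t : ℝ≥0,
    IdentDistrib (fun ω => X (s + t) ω - X s ω) (fun ω => X t ω - X 0 ω) P P
  rightCont : ∀ ω t, ContinuousWithinAt (fun s => X s ω) (Set.Ici t) t
  leftLim : ∀ ω t, ∃ l : ℝ, Tendsto (fun s => X s ω) (𝓝[<] t) (𝓝 l)

/-- `X` is a Lévy process under `P` with characteristic triplet `(b, a, ν)`, for the truncation
function `x 1_{|x| ≤ 1}`. -/
structure IsLevyProcessWithTriplet {Ω : Type*} [MeasurableSpace Ω] (X : ℝ≥0 → Ω → ℝ)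
    (P : Measure Ω) (b a : ℝ) (ν : Measure ℝ) : Prop where
  levy : IsLevyProcess X P
  gaussian_nonneg : 0 ≤ a
  levyMeasure : IsLevyMeasure ν
  charFun_eq : ∀ (t : ℝ≥0) (r : ℝ),
    charFun (P.map (X t)) r = Complex.exp (((t : ℝ) : ℂ) * levyExponent b a ν r)

/-- A random clock: a right-continuous nondecreasing process with `T₀ = 0`. -/
structure IsRandomClock {Ω : Type*} [MeasurableSpace Ω] (T : ℝ≥0 → Ω → ℝ≥0) : Prop where
  measurable : ∀ t, Measurable (T t)
  zero : ∀ ω, T 0 ω = 0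
  mono : ∀ ω, Monotone (fun t => T t ω)
  rightCont : ∀ ω t, ContinuousWithinAt (fun s => T s ω) (Set.Ici t) t

/-- `X` is a Lévy process under `P` with triplet `(b, a, ν)`, and `T` is a random clock that is
independent of the process `X`. -/
structure IsLevyWithIndepClock {Ω : Type*} [MeasurableSpace Ω] (X : ℝ≥0 → Ω → ℝ)
    (T : ℝ≥0 → Ω → ℝ≥0) (P : Measure Ω) (b a : ℝ) (ν : Measure ℝ) : Prop where
  levy : IsLevyProcessWithTriplet X P b a ν
  clock : IsRandomClock T
  indep : IndepFun (fun ω t => X t ω) (fun ω t => T t ω) P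

/-- The time-changed process `Z_t = X_{T_t}`. -/
def timeChange {Ω : Type*} (X : ℝ≥0 → Ω → ℝ) (T : ℝ≥0 → Ω → ℝ≥0) : ℝ≥0 → Ω → ℝ :=
  fun t ω => X (T t ω) ω

/-- The measure `B ↦ E (e^{Z_t} 1_B)`, for the horizon `t`. -/
def shareMeasure {Ω : Type*} [MeasurableSpace Ω] (P : Measure Ω) (Z : ℝ≥0 → Ω → ℝ) (t : ℝ≥0) :
    Measure Ω :=
  P.withDensity (fun ω => ENNReal.ofReal (Real.exp (Z t ω)))

/-- The σ-algebra `σ(Z_s, T_s : s ≤ t)`. -/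
abbrev sigmaUpTo {Ω : Type*} (Z : ℝ≥0 → Ω → ℝ) (T : ℝ≥0 → Ω → ℝ≥0) (t : ℝ≥0) :
    MeasurableSpace Ω :=
  ⨆ s : Set.Iic t, (MeasurableSpace.comap (Z s) inferInstance ⊔
    MeasurableSpace.comap (T s) inferInstance)

/-- The σ-algebra generated by the `P`-null events. -/
abbrev nullSigma {Ω : Type*} [MeasurableSpace Ω] (P : Measure Ω) : MeasurableSpace Ω :=
  MeasurableSpace.generateFrom {B | MeasurableSet B ∧ P B = 0}

/-- The measure on `ℝ` with density `ν`. -/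
def densityMeasure (ν : ℝ → ℝ) : Measure ℝ :=
  volume.withDensity (fun x => ENNReal.ofReal (ν x))

/-- The exponentially tilted density `ν*(x) = e^x ν(x)`. -/
def tiltedDensity (ν : ℝ → ℝ) : ℝ → ℝ := fun x => Real.exp x * ν x

/-- The tilted drift `b* = b + ∫_{|x| ≤ 1} x (e^x - 1) ν(x) dx + σ²`. -/
def tiltedDrift (b σ : ℝ) (ν : ℝ → ℝ) : ℝ :=
  b + (∫ x in {x : ℝ | |x| ≤ 1}, x * (Real.exp x - 1) * ν x) + σ ^ 2

end

/-! ### Compound Poisson laws and their complex Laplace transforms. -/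

section CompoundPoisson

variable {𝕜 : Type*} [RCLike 𝕜] {f : ℝ → 𝕜}

/-! Write Ψ for `levyLaplace`, so that the exponent of X is Ψ(iu). The martingale condition says
Ψ(1) = 0. Conditionally on the clock, the density e^{Z_t} is e^{X_r} at the deterministic time r =
T_t, and every earlier clock value is at most r. The theorem thus reduces to the Esscher transform
of X at a fixed time: under e^{X_r} P, the increments up to r are independent and stationary with
exponent u ↦ Ψ(1 + iu). Expanding Ψ(1 + iu) - Ψ(1) gives the Lévy-Khintchine exponent of (b*, σ²,
ν*) (`IsLevyMeasure.levyLaplace_one_add_sub`).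

The analytic difficulty is that the triplet prescribes E e^{zX_t} only for imaginary z, while its
value on 1 + iℝ is needed, including the finiteness of E e^{X_t}. Removing the jumps smaller than
1/(n+1) leaves a Gaussian law convolved with a compound Poisson law, where the formula is explicit
on the strip 0 ≤ Re z ≤ 1. Both these laws and their Esscher transforms have convergent
characteristic functions. Tightness of the transforms supplies a probability limit, so no
exponential mass is lost (`IsLevyMeasure.exists_withDensity_exp_eq`).

Increments determine the law of a process through joint characteristic functions
(`HasLevyIncrements.identDistrib`). The passage to a random time uses Fubini on a product space,
once right-continuity has shown that the time-changed law depends only on the joint law of process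
and clock (`identDistrib_shareMeasure_timeChange`). A process with the tilted triplet is made from
i.i.d. copies of X on [0, 1] under the tilted measure, run one after another, which keeps the càdlàg
paths (`exists_isLevyWithIndepClock`). Total mass one and consistency in t follow from the identity
of laws. -/

theorem integrable_conv_of_map_add {μ ν : Measure ℝ} [SFinite μ] [SFinite ν]
    (hf : Measurable f) (hadd : ∀ x y, f (x + y) = f x * f y)
    (hμ : Integrable f μ) (hν : Integrable f ν) : Integrable f (μ.conv ν) := by
  rw [Measure.conv, integrable_map_measure hf.aestronglyMeasurable (by fun_prop)]
  refine (hμ.mul_prod hν).congr (ae_of_all _ fun p => ?_)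
  simp [hadd]

theorem integral_conv_of_map_add {μ ν : Measure ℝ} [SFinite μ] [SFinite ν]
    (hf : Measurable f) (hadd : ∀ x y, f (x + y) = f x * f y) :
    ∫ x, f x ∂(μ.conv ν) = (∫ x, f x ∂μ) * ∫ x, f x ∂ν := by
  rw [Measure.conv, integral_map (by fun_prop) hf.aestronglyMeasurable]
  simp only [hadd]
  exact integral_prod_mul f f

/-- The `k`-fold convolution power of a measure on `ℝ`. -/
noncomputable def convPow (ρ : Measure ℝ) : ℕ → Measure ℝ
  | 0 => Measure.dirac 0
  | k + 1 => ρ.conv (convPow ρ k)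

instance isFiniteMeasure_convPow (ρ : Measure ℝ) [IsFiniteMeasure ρ] (k : ℕ) :
    IsFiniteMeasure (convPow ρ k) := by
  induction k with
  | zero => unfold convPow; infer_instance
  | succ k ih => unfold convPow; infer_instance

theorem integrable_convPow {ρ : Measure ℝ} [IsFiniteMeasure ρ] (hf : Measurable f)
    (hadd : ∀ x y, f (x + y) = f x * f y) (hρ : Integrable f ρ) (k : ℕ) :
    Integrable f (convPow ρ k) := by
  induction k with
  | zero => exact integrable_dirac (by simp)
  | succ k ih => exact integrable_conv_of_map_add hf hadd hρ ih

theorem integral_convPow {ρ : Measure ℝ} [IsFiniteMeasure ρ] (hf : Measurable f)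
    (hadd : ∀ x y, f (x + y) = f x * f y) (hzero : f 0 = 1) (k : ℕ) :
    ∫ x, f x ∂(convPow ρ k) = (∫ x, f x ∂ρ) ^ k := by
  induction k with
  | zero => simp [convPow, hzero]
  | succ k ih => rw [convPow, integral_conv_of_map_add hf hadd, ih, pow_succ']

/-- The compound Poisson law with jump measure `ρ`. -/
noncomputable def compoundPoisson (ρ : Measure ℝ) : Measure ℝ :=
  Measure.sum fun k : ℕ =>
    ENNReal.ofReal (Real.exp (-ρ.real Set.univ) / k.factorial) • convPow ρ k

theorem measurable_cexp_mul (z : ℂ) : Measurable fun x : ℝ => Complex.exp (z * x) := by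
  fun_prop

theorem norm_cexp_mul_ofReal (z : ℂ) (x : ℝ) :
    ‖Complex.exp (z * x)‖ = Real.exp (z.re * x) := by
  simp [Complex.norm_exp]

theorem cexp_mul_add (z : ℂ) (x y : ℝ) :
    Complex.exp (z * (x + y : ℝ)) = Complex.exp (z * x) * Complex.exp (z * y) := by
  rw [← Complex.exp_add]; push_cast; ring_nf

/-- The absolute value |e^{zx}| is again multiplicative, so its integrals against the convolution
powers are powers of one number, and the total is an exponential series. -/
theorem integrable_cexp_compoundPoisson {ρ : Measure ℝ} [IsFiniteMeasure ρ] {z : ℂ}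
    (hρ : Integrable (fun x : ℝ => Complex.exp (z * x)) ρ) :
    Integrable (fun x : ℝ => Complex.exp (z * x)) (compoundPoisson ρ) := by
  refine integrable_sum_measure (fun k => ?_) ?_
  · exact (integrable_convPow (measurable_cexp_mul z) (cexp_mul_add z) hρ k).smul_measure
      ENNReal.ofReal_ne_top
  · have h (k : ℕ) : ∫ x : ℝ, ‖Complex.exp (z * x)‖
        ∂(ENNReal.ofReal (Real.exp (-ρ.real Set.univ) / k.factorial) • convPow ρ k)
        = Real.exp (-ρ.real Set.univ) * ((∫ x : ℝ, ‖Complex.exp (z * x)‖ ∂ρ) ^ k / k.factorial) := by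
      rw [integral_smul_measure, ENNReal.toReal_ofReal (by positivity), smul_eq_mul,
        integral_convPow (f := fun x : ℝ => ‖Complex.exp (z * x)‖)
          (measurable_cexp_mul z).norm (fun x y => by rw [cexp_mul_add, norm_mul]) (by simp)]
      ring
    simp only [h]
    exact (Real.summable_pow_div_factorial _).mul_left _

/-- The k-th term is the k-th term of an exponential series; the factor exp(-ρ(ℝ)) produces the -1
in the exponent. -/
theorem integral_cexp_compoundPoisson {ρ : Measure ℝ} [IsFiniteMeasure ρ] {z : ℂ}
    (hρ : Integrable (fun x : ℝ => Complex.exp (z * x)) ρ) :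
    ∫ x : ℝ, Complex.exp (z * x) ∂(compoundPoisson ρ)
      = Complex.exp (∫ x : ℝ, (Complex.exp (z * x) - 1) ∂ρ) := by
  have h := hasSum_integral_measure (integrable_cexp_compoundPoisson hρ)
  refine h.unique ?_
  have h2 (k : ℕ) : ∫ x : ℝ, Complex.exp (z * x)
        ∂(ENNReal.ofReal (Real.exp (-ρ.real Set.univ) / k.factorial) • convPow ρ k)
        = Complex.exp (-ρ.real Set.univ)
          * ((k.factorial : ℂ)⁻¹ • (∫ x : ℝ, Complex.exp (z * x) ∂ρ) ^ k) := by
    rw [integral_smul_measure, ENNReal.toReal_ofReal (by positivity),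
      integral_convPow (measurable_cexp_mul z) (cexp_mul_add z) (by simp)]
    simp [div_eq_mul_inv]
    ring
  simp only [h2]
  rw [integral_sub hρ (integrable_const _)]
  simp only [integral_const, Complex.real_smul, mul_one]
  rw [sub_eq_neg_add, Complex.exp_add]
  refine HasSum.mul_left _ ?_
  rw [Complex.exp_eq_exp_ℂ]
  exact NormedSpace.exp_series_hasSum_exp' (𝕂 := ℂ) _

theorem isProbabilityMeasure_of_integral_cexp_zero {μ : Measure ℝ}
    (h : ∫ x : ℝ, Complex.exp (0 * x) ∂μ = 1) : IsProbabilityMeasure μ := by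
  have h1 : μ.real Set.univ = 1 := by
    have : ((μ.real Set.univ : ℝ) : ℂ) = 1 := by simpa using h
    exact_mod_cast this
  constructor
  rwa [Measure.real, ENNReal.toReal_eq_one_iff] at h1

instance isProbabilityMeasure_compoundPoisson (ρ : Measure ℝ) [IsFiniteMeasure ρ] :
    IsProbabilityMeasure (compoundPoisson ρ) := by
  refine isProbabilityMeasure_of_integral_cexp_zero ?_
  rw [integral_cexp_compoundPoisson (by simp)]
  simp

end CompoundPoisson

/-! ### The exponent at complex arguments, and laws with finite jump measure. -/

section LevyLaplace

theorem measurable_smallJump : Measurable smallJump := by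
  unfold smallJump
  exact Measurable.ite (measurableSet_le (by fun_prop) (by fun_prop)) measurable_id
    measurable_const

theorem abs_smallJump_le_one (x : ℝ) : |smallJump x| ≤ 1 := by
  unfold smallJump
  split_ifs with h <;> simp [h]

theorem integrable_smallJump (ρ : Measure ℝ) [IsFiniteMeasure ρ] : Integrable smallJump ρ :=
  Integrable.of_bound measurable_smallJump.aestronglyMeasurable 1
    (ae_of_all _ fun x => by simpa using abs_smallJump_le_one x)

/-- The compensated exponential `e^{zx} - 1 - z x 1_{|x| ≤ 1}`. -/
noncomputable def compensatedExp (z : ℂ) (x : ℝ) : ℂ :=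
  Complex.exp (z * x) - 1 - z * (smallJump x : ℂ)

theorem measurable_compensatedExp (z : ℂ) : Measurable (compensatedExp z) := by
  have := measurable_smallJump
  unfold compensatedExp
  fun_prop

theorem continuous_compensatedExp_left (x : ℝ) : Continuous fun z => compensatedExp z x := by
  unfold compensatedExp
  fun_prop

/-- The logarithm of the Laplace transform of the infinitely divisible law with triplet
`(b, a, ν)`. -/
noncomputable def levyLaplace (b a : ℝ) (ν : Measure ℝ) (z : ℂ) : ℂ :=
  z * b + a * z ^ 2 / 2 + ∫ x : ℝ, compensatedExp z x ∂ν

theorem levyLaplace_I_mul (b a : ℝ) (ν : Measure ℝ) (r : ℝ) :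
    levyLaplace b a ν (Complex.I * r) = levyExponent b a ν r := by
  simp only [levyLaplace, levyExponent, compensatedExp, mul_pow, Complex.I_sq]
  ring

/-- With finitely many jumps per unit time no compensation is needed: the law is Gaussian convolved
with compound Poisson, and the Gaussian mean absorbs the compensator ∫ `smallJump` dρ. -/
theorem exists_law_levyLaplace_of_isFiniteMeasure (b : ℝ) (a : ℝ≥0) (ρ : Measure ℝ)
    [IsFiniteMeasure ρ] :
    ∃ μ : Measure ℝ, IsProbabilityMeasure μ ∧
      ∀ z : ℂ, Integrable (fun x : ℝ => Complex.exp (z * x)) ρ →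
        Integrable (fun x : ℝ => Complex.exp (z * x)) μ ∧
        ∫ x : ℝ, Complex.exp (z * x) ∂μ = Complex.exp (levyLaplace b a ρ z) := by
  refine ⟨(gaussianReal (b - ∫ x, smallJump x ∂ρ) a).conv (compoundPoisson ρ),
    inferInstance, fun z hz => ⟨?_, ?_⟩⟩
  · refine integrable_conv_of_map_add (measurable_cexp_mul z) (cexp_mul_add z) ?_
      (integrable_cexp_compoundPoisson hz)
    refine (integrable_norm_iff (measurable_cexp_mul z).aestronglyMeasurable).1 ?_
    simp only [norm_cexp_mul_ofReal]
    exact integrable_exp_mul_gaussianReal _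
  · rw [integral_conv_of_map_add (measurable_cexp_mul z) (cexp_mul_add z),
      integral_cexp_compoundPoisson hz]
    have h := complexMGF_id_gaussianReal (μ := b - ∫ x, smallJump x ∂ρ) (v := a) z
    simp only [complexMGF, id] at h
    rw [h, ← Complex.exp_add]
    congr 1
    have hs : Integrable (fun x => z * (smallJump x : ℂ)) ρ :=
      (integrable_smallJump ρ).ofReal.const_mul z
    unfold levyLaplace compensatedExp
    have hz' : Integrable (fun x : ℝ => Complex.exp (z * x) - 1) ρ := hz.sub (integrable_const _)
    rw [integral_sub hz' hs, integral_const_mul, integral_complex_ofReal]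
    push_cast
    ring

end LevyLaplace

/-! ### Truncation of small jumps and convergence of the exponents. -/

section LevyTruncation

variable {ν : Measure ℝ}

theorem IsLevyMeasure.integrable_min_one_sq (hν : IsLevyMeasure ν) :
    Integrable (fun x : ℝ => min 1 (x ^ 2)) ν := by
  refine ⟨by fun_prop, ?_⟩
  rw [hasFiniteIntegral_iff_ofReal (ae_of_all _ fun x => by positivity)]
  exact hν.lintegral_lt_top

theorem IsLevyMeasure.measure_lt_abs_lt_top (hν : IsLevyMeasure ν) {ε : ℝ} (hε : 0 < ε) :
    ν {x | ε < |x|} < ∞ := by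
  have h := hν.integrable_min_one_sq.measure_ge_lt_top (ε := min 1 (ε ^ 2)) (by positivity)
  refine lt_of_le_of_lt (measure_mono fun x hx => ?_) h
  have hx : ε < |x| := hx
  have : ε ^ 2 ≤ x ^ 2 := by
    rw [← sq_abs x]; gcongr
  exact min_le_min_left _ this

/-- For |x| ≤ 1 this is the second-order Taylor remainder; for |x| > 1 the condition 0 ≤ Re z ≤ 1
gives |e^{zx}| ≤ 1 + e^x. Uniformity over |z| ≤ R makes the bound usable for domination. -/
theorem norm_compensatedExp_le {z : ℂ} (h0 : 0 ≤ z.re) (h1 : z.re ≤ 1) {R : ℝ} (hz : ‖z‖ ≤ R)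
    (x : ℝ) :
    ‖compensatedExp z x‖ ≤ (R ^ 2 * Real.exp R + 2) * min 1 (x ^ 2)
      + {x : ℝ | 1 < |x|}.indicator Real.exp x := by
  have hR : 0 ≤ R := (norm_nonneg z).trans hz
  by_cases hx : |x| ≤ 1
  · have hx2 : x ^ 2 ≤ 1 := by rw [← sq_abs]; exact pow_le_one₀ (abs_nonneg x) hx
    have hind : {x : ℝ | 1 < |x|}.indicator Real.exp x = 0 :=
      Set.indicator_of_notMem (by simpa using hx) _
    rw [hind, add_zero, min_eq_right hx2, compensatedExp, smallJump, if_pos hx]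
    have h := Complex.norm_exp_sub_sum_le_norm_mul_exp (z * x) 2
    have hs : ∑ m ∈ Finset.range 2, (z * x) ^ m / (m.factorial : ℂ) = 1 + z * x := by
      simp [Finset.sum_range_succ]
    rw [hs, ← sub_sub] at h
    refine h.trans ?_
    have hn : ‖z * (x : ℂ)‖ = ‖z‖ * |x| := by simp
    have hn' : ‖z‖ * |x| ≤ R := by
      calc ‖z‖ * |x| ≤ R * 1 := by gcongr
        _ = R := mul_one R
    rw [hn, mul_pow, sq_abs]
    calc ‖z‖ ^ 2 * x ^ 2 * Real.exp (‖z‖ * |x|) ≤ R ^ 2 * x ^ 2 * Real.exp R := by gcongr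
      _ ≤ (R ^ 2 * Real.exp R + 2) * x ^ 2 := by nlinarith [sq_nonneg x]
  · have hx' : 1 < |x| := not_le.1 hx
    have hx2 : 1 ≤ x ^ 2 := by rw [← sq_abs]; exact one_le_pow₀ hx'.le
    have hind : {x : ℝ | 1 < |x|}.indicator Real.exp x = Real.exp x :=
      Set.indicator_of_mem (s := {x : ℝ | 1 < |x|}) hx' _
    rw [hind, min_eq_left hx2, compensatedExp, smallJump, if_neg hx]
    simp only [Complex.ofReal_zero, mul_zero, sub_zero, mul_one]
    have h2 : ‖Complex.exp (z * x)‖ ≤ 1 + Real.exp x := by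
      rw [norm_cexp_mul_ofReal]
      rcases le_total 0 x with h | h
      · have : Real.exp (z.re * x) ≤ Real.exp x := Real.exp_le_exp.2 (by nlinarith)
        linarith
      · have : Real.exp (z.re * x) ≤ 1 := Real.exp_le_one_iff.2 (by nlinarith)
        linarith [Real.exp_pos x]
    have h3 := norm_sub_le (Complex.exp (z * x)) 1
    simp only [norm_one] at h3
    have : 0 ≤ R ^ 2 * Real.exp R := by positivity
    linarith

theorem IsLevyMeasure.integrable_compensatedExp_bound (hν : IsLevyMeasure ν)
    (hexp : IntegrableOn Real.exp {x | 1 < |x|} ν) (C : ℝ) :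
    Integrable (fun x : ℝ => C * min 1 (x ^ 2) + {x : ℝ | 1 < |x|}.indicator Real.exp x) ν :=
  (hν.integrable_min_one_sq.const_mul C).add
    (hexp.integrable_indicator (measurableSet_lt (by fun_prop) (by fun_prop)))

theorem IsLevyMeasure.integrable_compensatedExp (hν : IsLevyMeasure ν)
    (hexp : IntegrableOn Real.exp {x | 1 < |x|} ν) {z : ℂ} (h0 : 0 ≤ z.re) (h1 : z.re ≤ 1) :
    Integrable (compensatedExp z) ν :=
  (hν.integrable_compensatedExp_bound hexp _).mono'
    (measurable_compensatedExp z).aestronglyMeasurable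
    (ae_of_all _ fun x => norm_compensatedExp_le h0 h1 le_rfl x)

/-- The complement of the ball of radius `1 / (n + 1)`. -/
def awayFromZero (n : ℕ) : Set ℝ := {x | 1 / ((n : ℝ) + 1) < |x|}

theorem measurableSet_awayFromZero (n : ℕ) : MeasurableSet (awayFromZero n) :=
  measurableSet_lt (by fun_prop) (by fun_prop)

theorem monotone_awayFromZero : Monotone awayFromZero := by
  intro m n h x hx
  have hx : 1 / ((m : ℝ) + 1) < |x| := hx
  exact lt_of_le_of_lt (Nat.one_div_le_one_div h) hx

theorem iUnion_awayFromZero : ⋃ n, awayFromZero n = {0}ᶜ := by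
  ext x
  simp only [Set.mem_iUnion, awayFromZero, Set.mem_ofPred_eq, Set.mem_compl_iff,
    Set.mem_singleton_iff]
  constructor
  · rintro ⟨n, hn⟩ rfl
    rw [abs_zero] at hn
    exact absurd hn (not_lt.2 (by positivity))
  · intro hx
    exact exists_nat_one_div_lt (abs_pos.2 hx)

/-- The truncation sets increase to ℝ \ {0}, which carries all of ν, and the compensated exponential
is integrable. -/
theorem tendsto_levyLaplace_restrict (hν : IsLevyMeasure ν)
    (hexp : IntegrableOn Real.exp {x | 1 < |x|} ν) (b a : ℝ) {z : ℂ} (h0 : 0 ≤ z.re)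
    (h1 : z.re ≤ 1) :
    Tendsto (fun n => levyLaplace b a (ν.restrict (awayFromZero n)) z) atTop
      (𝓝 (levyLaplace b a ν z)) := by
  have h := tendsto_setIntegral_of_monotone (f := compensatedExp z) (μ := ν)
    measurableSet_awayFromZero monotone_awayFromZero
    (hν.integrable_compensatedExp hexp h0 h1).integrableOn
  have h2 : ν.restrict (⋃ n, awayFromZero n) = ν := by
    rw [iUnion_awayFromZero]
    refine Measure.restrict_eq_self_of_ae_mem ?_
    rw [ae_iff]
    simpa using hν.zero
  rw [h2] at h
  exact tendsto_const_nhds.add h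

/-- Continuity at 0 is what the Lévy continuity argument needs to get tightness. Domination uses the
radius R = 2, since |1 + ir| ≤ 2 for |r| < 1. -/
theorem continuousAt_levyLaplace_one_add (hν : IsLevyMeasure ν)
    (hexp : IntegrableOn Real.exp {x | 1 < |x|} ν) (b a : ℝ) :
    ContinuousAt (fun r : ℝ => levyLaplace b a ν (1 + Complex.I * r)) 0 := by
  unfold levyLaplace
  refine ContinuousAt.add (by fun_prop) ?_
  refine continuousAt_of_dominated
    (bound := fun x => (2 ^ 2 * Real.exp 2 + 2) * min 1 (x ^ 2)
      + {x : ℝ | 1 < |x|}.indicator Real.exp x) ?_ ?_ ?_ ?_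
  · exact Eventually.of_forall fun r => (measurable_compensatedExp _).aestronglyMeasurable
  · have : ∀ᶠ r : ℝ in 𝓝 0, |r| < 1 := by
      have := (continuous_abs (G := ℝ)).tendsto 0
      rw [abs_zero] at this
      exact this.eventually (gt_mem_nhds one_pos)
    filter_upwards [this] with r hr
    refine ae_of_all _ fun x => norm_compensatedExp_le (by simp) (by simp) ?_ x
    refine (norm_add_le _ _).trans ?_
    simp only [norm_one, norm_mul, Complex.norm_I, Complex.norm_real, Real.norm_eq_abs, one_mul]
    linarith
  · exact hν.integrable_compensatedExp_bound hexp _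
  · refine ae_of_all _ fun x => Continuous.continuousAt ?_
    exact (continuous_compensatedExp_left x).comp (by fun_prop)

theorem exists_law_levyLaplace_restrict (hν : IsLevyMeasure ν)
    (hexp : IntegrableOn Real.exp {x | 1 < |x|} ν) (b : ℝ) (a : ℝ≥0) (n : ℕ) :
    ∃ μ : Measure ℝ, IsProbabilityMeasure μ ∧ ∀ z : ℂ, 0 ≤ z.re → z.re ≤ 1 →
      Integrable (fun x : ℝ => Complex.exp (z * x)) μ ∧
      ∫ x : ℝ, Complex.exp (z * x) ∂μ
        = Complex.exp (levyLaplace b a (ν.restrict (awayFromZero n)) z) := by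
  have : IsFiniteMeasure (ν.restrict (awayFromZero n)) :=
    isFiniteMeasure_restrict.2 (hν.measure_lt_abs_lt_top (by positivity)).ne
  obtain ⟨μ, hμ, h⟩ := exists_law_levyLaplace_of_isFiniteMeasure b a
    (ν.restrict (awayFromZero n))
  refine ⟨μ, hμ, fun z h0 h1 => h z ?_⟩
  -- The two terms added back are bounded, hence integrable against the finite truncated measure.
  have h2 : Integrable (fun x => compensatedExp z x + (1 + z * (smallJump x : ℂ)))
      (ν.restrict (awayFromZero n)) :=
    (hν.integrable_compensatedExp hexp h0 h1).restrict.add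
      ((integrable_const _).add ((integrable_smallJump _).ofReal.const_mul z))
  refine h2.congr (ae_of_all _ fun x => ?_)
  simp only [compensatedExp]
  ring

end LevyTruncation

/-! ### Exponential moments by passage to the limit in Esscher transforms. -/

section LevyExponentialMoment

open BoundedContinuousFunction in
/-- A sequence of probability measures whose characteristic functions converge to a function that
is continuous at `0` converges weakly along an ultrafilter, to a measure with that characteristic
function. -/
theorem exists_tendsto_ultrafilter_of_tendsto_charFun {κ : ℕ → ProbabilityMeasure ℝ} {φ : ℝ → ℂ}
    (hφ : ContinuousAt φ 0)
    (h : ∀ r, Tendsto (fun n => charFun (κ n : Measure ℝ) r) atTop (𝓝 (φ r))) :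
    ∃ (U : Ultrafilter ℕ) (κ₀ : ProbabilityMeasure ℝ), (U : Filter ℕ) ≤ atTop ∧
      Tendsto κ U (𝓝 κ₀) ∧ ∀ r, charFun (κ₀ : Measure ℝ) r = φ r := by
  have htight : IsTightMeasureSet (Set.range fun n => (κ n : Measure ℝ)) :=
    isTightMeasureSet_of_tendsto_charFun hφ h
  have hcomp : IsCompact (closure (Set.range κ)) :=
    isCompact_closure_of_isTightMeasureSet (by
      convert htight using 1
      ext m
      simp)
  -- An ultrafilter finer than `atTop` plays the role of a convergent subsequence: by compactness
  -- its image converges.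
  have hU : ((Ultrafilter.of atTop : Ultrafilter ℕ) : Filter ℕ) ≤ atTop := Ultrafilter.of_le _
  obtain ⟨κ₀, -, hκ₀⟩ := hcomp.ultrafilter_le_nhds ((Ultrafilter.of atTop).map κ) (by
    refine le_trans ?_ (monotone_principal subset_closure)
    rw [le_principal_iff]
    exact Filter.mem_of_superset (Filter.image_mem_map Filter.univ_mem) (by simp))
  have hκ : Tendsto κ (Ultrafilter.of atTop : Ultrafilter ℕ) (𝓝 κ₀) := hκ₀
  refine ⟨Ultrafilter.of atTop, κ₀, hU, hκ, fun r => ?_⟩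
  refine tendsto_nhds_unique ?_ ((h r).mono_left hU)
  rw [ProbabilityMeasure.tendsto_iff_forall_integral_rclike_tendsto ℂ] at hκ
  simp_rw [charFun_eq_integral_innerProbChar]
  exact hκ (innerProbChar r)

/-- The bounded continuous function `min 1 ∘ exp`. -/
noncomputable def minOneExp : BoundedContinuousFunction ℝ ℝ :=
  BoundedContinuousFunction.ofNormedAddCommGroup (fun x => min 1 (Real.exp x)) (by fun_prop) 1
    (fun x => by
      rw [Real.norm_of_nonneg (by positivity)]
      exact min_le_left _ _)

/-- The bounded continuous function `x ↦ min 1 (exp (-x))`. -/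
noncomputable def minOneExpNeg : BoundedContinuousFunction ℝ ℝ :=
  BoundedContinuousFunction.ofNormedAddCommGroup (fun x => min 1 (Real.exp (-x))) (by fun_prop) 1
    (fun x => by
      rw [Real.norm_of_nonneg (by positivity)]
      exact min_le_left _ _)

theorem minOneExp_apply (x : ℝ) : minOneExp x = min 1 (Real.exp x) := rfl

theorem minOneExpNeg_apply (x : ℝ) : minOneExpNeg x = min 1 (Real.exp (-x)) := rfl

theorem exp_mul_minOneExpNeg (x : ℝ) : Real.exp x * minOneExpNeg x = minOneExp x := by
  rw [minOneExp_apply, minOneExpNeg_apply, mul_min_of_nonneg _ _ (Real.exp_pos x).le,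
    ← Real.exp_add, add_neg_cancel, Real.exp_zero, mul_one, min_comm]

/-- The density e^x is unbounded, so weak limits cannot test e^x μ = c κ directly. Damping both
sides by min(1, e^{-x}) makes the weights bounded; multiplying by max(1, e^x) then undoes the
damping. -/
theorem withDensity_exp_eq_smul_of_integral_eq {μ κ : Measure ℝ} [IsFiniteMeasure μ]
    [IsFiniteMeasure κ] {c : ℝ} (hc : 0 ≤ c)
    (h : ∀ f : BoundedContinuousFunction ℝ ℝ,
      ∫ x, f x * minOneExp x ∂μ = c * ∫ x, f x * minOneExpNeg x ∂κ) :
    μ.withDensity (fun x => ENNReal.ofReal (Real.exp x)) = ENNReal.ofReal c • κ := by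
  have hm1 : Measurable fun x => ENNReal.ofReal (minOneExp x) := by fun_prop
  have hm2 : Measurable fun x => ENNReal.ofReal (c * minOneExpNeg x) := by fun_prop
  have hpos1 (x : ℝ) : 0 ≤ minOneExp x := by rw [minOneExp_apply]; positivity
  have hpos2 (x : ℝ) : 0 ≤ c * minOneExpNeg x := by rw [minOneExpNeg_apply]; positivity
  have hi1 : Integrable minOneExp μ := minOneExp.integrable μ
  have hi2 : Integrable (fun x => c * minOneExpNeg x) κ := (minOneExpNeg.integrable κ).const_mul c
  have key : μ.withDensity (fun x => ENNReal.ofReal (minOneExp x))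
      = κ.withDensity (fun x => ENNReal.ofReal (c * minOneExpNeg x)) := by
    have : IsFiniteMeasure (μ.withDensity (fun x => ENNReal.ofReal (minOneExp x))) :=
      isFiniteMeasure_withDensity_ofReal hi1.2
    have : IsFiniteMeasure (κ.withDensity (fun x => ENNReal.ofReal (c * minOneExpNeg x))) :=
      isFiniteMeasure_withDensity_ofReal hi2.2
    refine ext_of_forall_integral_eq_of_IsFiniteMeasure fun f => ?_
    rw [integral_withDensity_eq_integral_toReal_smul hm1 (by simp),
      integral_withDensity_eq_integral_toReal_smul hm2 (by simp)]
    simp only [ENNReal.toReal_ofReal (hpos1 _), ENNReal.toReal_ofReal (hpos2 _), smul_eq_mul]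
    have := h f
    rw [← integral_const_mul] at this
    calc _ = ∫ x, f x * minOneExp x ∂μ := by simp only [mul_comm]
      _ = _ := by rw [this]; congr 1; ext x; ring
  have hm3 : Measurable fun x => ENNReal.ofReal (max 1 (Real.exp x)) := by fun_prop
  have e1 : (fun x => ENNReal.ofReal (Real.exp x))
      = (fun x => ENNReal.ofReal (minOneExp x)) * fun x => ENNReal.ofReal (max 1 (Real.exp x)) := by
    ext x
    rw [Pi.mul_apply, ← ENNReal.ofReal_mul (hpos1 x), minOneExp_apply, min_mul_max, one_mul]
  have e2 : (fun _ => ENNReal.ofReal c)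
      = (fun x => ENNReal.ofReal (c * minOneExpNeg x))
        * fun x => ENNReal.ofReal (max 1 (Real.exp x)) := by
    ext x
    rw [Pi.mul_apply, ← ENNReal.ofReal_mul (hpos2 x), minOneExpNeg_apply]
    congr 1
    rcases le_total 0 x with hx | hx
    · rw [min_eq_right (by simpa using hx), max_eq_right (by simpa using hx), mul_assoc,
        ← Real.exp_add]
      simp
    · rw [min_eq_left (by simpa using hx), max_eq_left (by simpa using hx)]
      simp
  rw [e1, withDensity_mul _ hm1 hm3, key, ← withDensity_mul _ hm2 hm3, ← e2, withDensity_const]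

variable {ν : Measure ℝ}

/-- The truncated laws μ_n converge weakly to μ, and their Esscher transforms κ_n = e^x μ_n / c_n
converge along an ultrafilter to a probability measure κ. The relation e^x μ_n = c_n κ_n survives in
damped form, which gives the exponential moment of μ without assuming it. -/
theorem IsLevyMeasure.exists_withDensity_exp_eq (hν : IsLevyMeasure ν)
    (hexp : IntegrableOn Real.exp {x | 1 < |x|} ν) {μ : Measure ℝ} [IsProbabilityMeasure μ]
    {b : ℝ} {a : ℝ≥0} (hμ : ∀ r, charFun μ r = Complex.exp (levyExponent b a ν r)) :
    ∃ (c : ℝ) (κ : Measure ℝ), IsProbabilityMeasure κ ∧ 0 ≤ c ∧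
      (∀ r : ℝ, c * charFun κ r = Complex.exp (levyLaplace b a ν (1 + Complex.I * r))) ∧
      μ.withDensity (fun x => ENNReal.ofReal (Real.exp x)) = ENNReal.ofReal c • κ := by
  choose μn hprob hμn using exists_law_levyLaplace_restrict hν hexp b a
  have hint (n : ℕ) : Integrable Real.exp (μn n) := by
    have := ((hμn n 1 (by simp) (by simp)).1).norm
    simpa [norm_cexp_mul_ofReal] using this
  have hcpos (n : ℕ) : 0 < ∫ x, Real.exp x ∂(μn n) := integral_exp_pos (hint n)
  have hcn (n : ℕ) : ((∫ x, Real.exp x ∂(μn n) : ℝ) : ℂ)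
      = Complex.exp (levyLaplace b a (ν.restrict (awayFromZero n)) 1) := by
    rw [← (hμn n 1 (by simp) (by simp)).2, ← integral_complex_ofReal]
    simp
  have hlim {z : ℂ} (h0 : 0 ≤ z.re) (h1 : z.re ≤ 1) :
      Tendsto (fun n => Complex.exp (levyLaplace b a (ν.restrict (awayFromZero n)) z)) atTop
        (𝓝 (Complex.exp (levyLaplace b a ν z))) :=
    (Complex.continuous_exp.tendsto _).comp (tendsto_levyLaplace_restrict hν hexp b a h0 h1)
  set c : ℝ := (Complex.exp (levyLaplace b a ν 1)).re with hc_def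
  have hc_tendsto : Tendsto (fun n => ∫ x, Real.exp x ∂(μn n)) atTop (𝓝 c) := by
    have := (Complex.continuous_re.tendsto _).comp (hlim (z := 1) (by simp) (by simp))
    refine this.congr fun n => ?_
    rw [Function.comp_apply, ← hcn, Complex.ofReal_re]
  -- The complex exponential is real because it is the limit of the real normalizing constants;
  -- taking the real part loses nothing.
  have hc : (c : ℂ) = Complex.exp (levyLaplace b a ν 1) := by
    refine tendsto_nhds_unique ((Complex.continuous_ofReal.tendsto _).comp hc_tendsto) ?_
    exact (hlim (z := 1) (by simp) (by simp)).congr fun n => (hcn n).symm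
  have hc0 : (c : ℂ) ≠ 0 := by rw [hc]; exact Complex.exp_ne_zero _
  have hc_nonneg : 0 ≤ c := ge_of_tendsto' hc_tendsto fun n => (hcpos n).le
  have hprob' (n : ℕ) : IsProbabilityMeasure ((μn n).tilted id) :=
    isProbabilityMeasure_tilted (hint n)
  let κ (n : ℕ) : ProbabilityMeasure ℝ := ⟨(μn n).tilted id, hprob' n⟩
  have hκchar (n : ℕ) (r : ℝ) : charFun (κ n : Measure ℝ) r
      = Complex.exp (levyLaplace b a (ν.restrict (awayFromZero n)) (1 + Complex.I * r))
        / ((∫ x, Real.exp x ∂(μn n) : ℝ) : ℂ) := by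
    have h := (hμn n (1 + Complex.I * r) (by simp) (by simp)).2
    rw [← h, ← integral_div]
    change charFun ((μn n).tilted id) r = _
    rw [charFun_apply_real, integral_tilted]
    congr 1
    ext x
    simp only [id, Complex.real_smul, Complex.ofReal_div, Complex.ofReal_exp]
    rw [div_mul_eq_mul_div, ← Complex.exp_add]
    ring_nf
  obtain ⟨U, κ₀, hU, hκ, hκ₀⟩ := exists_tendsto_ultrafilter_of_tendsto_charFun (κ := κ)
    (φ := fun r => Complex.exp (levyLaplace b a ν (1 + Complex.I * r)) / c)
    (((Complex.continuous_exp.continuousAt).comp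
      (continuousAt_levyLaplace_one_add hν hexp b a)).div_const _)
    (fun r => by
      simp only [hκchar]
      exact (hlim (by simp) (by simp)).div
        ((Complex.continuous_ofReal.tendsto _).comp hc_tendsto) hc0)
  refine ⟨c, κ₀, inferInstance, hc_nonneg, fun r => ?_, ?_⟩
  · rw [hκ₀, mul_div_cancel₀ _ hc0]
  refine withDensity_exp_eq_smul_of_integral_eq hc_nonneg fun f => ?_
  let m (n : ℕ) : ProbabilityMeasure ℝ := ⟨μn n, hprob n⟩
  let m₀ : ProbabilityMeasure ℝ := ⟨μ, inferInstance⟩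
  have hμconv : Tendsto m atTop (𝓝 m₀) := by
    refine ProbabilityMeasure.tendsto_of_tendsto_charFun fun r => ?_
    change Tendsto (fun n => charFun (μn n) r) atTop (𝓝 (charFun μ r))
    rw [hμ, ← levyLaplace_I_mul]
    refine (hlim (z := Complex.I * r) (by simp) (by simp)).congr fun n => ?_
    rw [← (hμn n _ (by simp) (by simp)).2, charFun_apply_real]
    congr 1; ext x; ring_nf
  rw [ProbabilityMeasure.tendsto_iff_forall_integral_tendsto] at hμconv hκ
  have t1 : Tendsto (fun n => ∫ x, f x * minOneExp x ∂(μn n)) U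
      (𝓝 (∫ x, f x * minOneExp x ∂μ)) := (hμconv (f * minOneExp)).mono_left hU
  have t2 : Tendsto (fun n => ∫ x, f x * minOneExpNeg x ∂((μn n).tilted id)) U
      (𝓝 (∫ x, f x * minOneExpNeg x ∂κ₀)) := hκ (f * minOneExpNeg)
  -- Before the limit the two sides agree exactly, since e^x min(1, e^{-x}) = min(1, e^x) and c_n
  -- cancels the normalization of the tilting.
  refine tendsto_nhds_unique t1 (((hc_tendsto.mono_left hU).mul t2).congr fun n => ?_)
  rw [integral_tilted, ← integral_const_mul]
  congr 1
  ext x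
  have := (hcpos n).ne'
  simp only [id, smul_eq_mul]
  rw [← exp_mul_minOneExpNeg]
  field_simp

/-- An infinitely divisible law whose Lévy measure integrates `e^x` away from zero has an
exponential moment of order one, and its Laplace transform on the line `1 + iℝ` is given by the
Lévy-Khintchine formula. -/
theorem IsLevyMeasure.integral_cexp_one_add (hν : IsLevyMeasure ν)
    (hexp : IntegrableOn Real.exp {x | 1 < |x|} ν) {μ : Measure ℝ} [IsProbabilityMeasure μ]
    {b a : ℝ} (ha : 0 ≤ a) (hμ : ∀ r, charFun μ r = Complex.exp (levyExponent b a ν r)) :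
    Integrable Real.exp μ ∧ ∀ r : ℝ, ∫ x : ℝ, Complex.exp ((1 + Complex.I * r) * x) ∂μ
      = Complex.exp (levyLaplace b a ν (1 + Complex.I * r)) := by
  lift a to ℝ≥0 using ha
  obtain ⟨c, κ, hκ, hc, hchar, hdens⟩ := hν.exists_withDensity_exp_eq hexp hμ
  have hm : Measurable fun x => ENNReal.ofReal (Real.exp x) := by fun_prop
  refine ⟨⟨by fun_prop, ?_⟩, fun r => ?_⟩
  · rw [hasFiniteIntegral_iff_ofReal (ae_of_all _ fun x => (Real.exp_pos x).le)]
    -- Comparing total masses shows that the exponential moment is c, hence finite.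
    have := congrArg (fun m : Measure ℝ => m Set.univ) hdens
    simp only [withDensity_apply _ MeasurableSet.univ, Measure.restrict_univ, Measure.smul_apply,
      measure_univ, smul_eq_mul, mul_one] at this
    rw [this]
    exact ENNReal.ofReal_lt_top
  · have h := congrArg (fun m : Measure ℝ => charFun m r) hdens
    simp only [charFun_apply_real] at h hchar
    rw [integral_smul_measure, ENNReal.toReal_ofReal hc, Complex.real_smul,
      hchar, integral_withDensity_eq_integral_toReal_smul hm (by simp)] at h
    rw [← h]
    congr 1
    ext x
    rw [ENNReal.toReal_ofReal (Real.exp_pos x).le, Complex.real_smul, Complex.ofReal_exp,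
      ← Complex.exp_add]
    ring_nf

end LevyExponentialMoment

/-! ### From one infinitely divisible law to all times. -/

section TimeScaling

variable {ν : Measure ℝ}

theorem IsLevyMeasure.smul (hν : IsLevyMeasure ν) (t : ℝ≥0) : IsLevyMeasure (t • ν) := by
  refine ⟨by simp [hν.zero], ?_⟩
  rw [lintegral_smul_measure]
  exact ENNReal.mul_lt_top (by simp) hν.lintegral_lt_top

theorem levyLaplace_smul (b a : ℝ) (ν : Measure ℝ) (t : ℝ≥0) (z : ℂ) :
    levyLaplace (t * b) (t * a) (t • ν) z = ((t : ℝ) : ℂ) * levyLaplace b a ν z := by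
  unfold levyLaplace
  rw [integral_smul_nnreal_measure, NNReal.smul_def, Complex.real_smul]
  push_cast
  ring

/-- The law of X_t is infinitely divisible with triplet (tb, ta, tν), so the result for a single law
applies. -/
theorem IsLevyProcessWithTriplet.integral_cexp_one_add {Ω : Type*} [MeasurableSpace Ω]
    {P : Measure Ω} [IsProbabilityMeasure P] {X : ℝ≥0 → Ω → ℝ} {b a : ℝ}
    (hX : IsLevyProcessWithTriplet X P b a ν) (hexp : IntegrableOn Real.exp {x | 1 < |x|} ν)
    (t : ℝ≥0) :
    Integrable Real.exp (P.map (X t)) ∧ ∀ r : ℝ,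
      ∫ x : ℝ, Complex.exp ((1 + Complex.I * r) * x) ∂(P.map (X t))
        = Complex.exp (((t : ℝ) : ℂ) * levyLaplace b a ν (1 + Complex.I * r)) := by
  have : IsProbabilityMeasure (P.map (X t)) :=
    Measure.isProbabilityMeasure_map (hX.levy.measurable t).aemeasurable
  have h := (hX.levyMeasure.smul t).integral_cexp_one_add (μ := P.map (X t)) (b := t * b)
    (a := t * a)
    (by rw [IntegrableOn, Measure.restrict_smul]
        exact Integrable.smul_measure_nnreal hexp)
    (mul_nonneg t.2 hX.gaussian_nonneg)
    (fun r => by rw [hX.charFun_eq, ← levyLaplace_I_mul, ← levyLaplace_I_mul, levyLaplace_smul])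
  simpa only [levyLaplace_smul] using h

end TimeScaling

/-! ### Algebra of the exponential tilt: the new drift and Lévy measure. -/

section Tilting

theorem compensatedExp_one (x : ℝ) :
    compensatedExp 1 x = ((Real.exp x - 1 - smallJump x : ℝ) : ℂ) := by
  simp [compensatedExp]

/-- The exponentials combine as e^x (e^{irx} - 1). The compensator must then carry the weight e^x as
well, and the mismatch x 1_{|x| ≤ 1} (e^x - 1) is the source of the drift correction. -/
theorem compensatedExp_one_add_sub (r x : ℝ) :
    compensatedExp (1 + Complex.I * r) x - compensatedExp 1 x
      = Real.exp x • compensatedExp (Complex.I * r) x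
        + Complex.I * r * ((smallJump x * (Real.exp x - 1) : ℝ) : ℂ) := by
  simp only [compensatedExp, Complex.real_smul, Complex.ofReal_mul, Complex.ofReal_sub,
    Complex.ofReal_exp, Complex.ofReal_one, add_mul, Complex.exp_add, one_mul]
  ring

variable {ν : Measure ℝ}

theorem IsLevyMeasure.integrable_smallJump_mul (hν : IsLevyMeasure ν) :
    Integrable (fun x => smallJump x * (Real.exp x - 1)) ν := by
  have := measurable_smallJump
  refine (hν.integrable_min_one_sq.const_mul 2).mono' (by fun_prop) (ae_of_all _ fun x => ?_)
  rw [Real.norm_eq_abs, abs_mul]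
  unfold smallJump
  split_ifs with hx
  · have hx2 : x ^ 2 ≤ 1 := by rw [← sq_abs]; exact pow_le_one₀ (abs_nonneg x) hx
    rw [min_eq_right hx2]
    have := Real.abs_exp_sub_one_le hx
    calc |x| * |Real.exp x - 1| ≤ |x| * (2 * |x|) := by gcongr
      _ = 2 * x ^ 2 := by rw [← sq_abs]; ring
  · simp only [abs_zero, zero_mul]
    positivity

/-- Besides the jump correction, a((1 + ir)² - 1)/2 = iar - ar²/2 contributes the extra drift a and
leaves the Gaussian variance unchanged. -/
theorem IsLevyMeasure.levyLaplace_one_add_sub (hν : IsLevyMeasure ν)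
    (hexp : IntegrableOn Real.exp {x | 1 < |x|} ν) (b a r : ℝ) :
    levyLaplace b a ν (1 + Complex.I * r) - levyLaplace b a ν 1
      = levyExponent (b + (∫ x, smallJump x * (Real.exp x - 1) ∂ν) + a) a
          (ν.withDensity fun x => ENNReal.ofReal (Real.exp x)) r := by
  have h1 := hν.integrable_compensatedExp hexp (z := 1 + Complex.I * r) (by simp) (by simp)
  have h2 := hν.integrable_compensatedExp hexp (z := 1) (by simp) (by simp)
  have h3 : Integrable
      (fun x => Complex.I * r * ((smallJump x * (Real.exp x - 1) : ℝ) : ℂ)) ν :=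
    hν.integrable_smallJump_mul.ofReal.const_mul _
  have h4 : Integrable (fun x => Real.exp x • compensatedExp (Complex.I * r) x) ν := by
    refine ((h1.sub h2).sub h3).congr (ae_of_all _ fun x => ?_)
    simp only [Pi.sub_apply]
    rw [compensatedExp_one_add_sub]
    ring
  have h5 : (∫ x, compensatedExp (1 + Complex.I * r) x ∂ν) - ∫ x, compensatedExp 1 x ∂ν
      = (∫ x, Real.exp x • compensatedExp (Complex.I * r) x ∂ν)
        + Complex.I * r * ((∫ x, smallJump x * (Real.exp x - 1) ∂ν : ℝ) : ℂ) := by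
    rw [← integral_sub h1 h2, ← integral_complex_ofReal, ← integral_const_mul,
      ← integral_add h4 h3]
    simp only [compensatedExp_one_add_sub]
  have h6 : ∫ x, compensatedExp (Complex.I * r) x
        ∂(ν.withDensity fun x => ENNReal.ofReal (Real.exp x))
      = ∫ x, Real.exp x • compensatedExp (Complex.I * r) x ∂ν := by
    rw [integral_withDensity_eq_integral_toReal_smul (by fun_prop) (by simp)]
    simp only [ENNReal.toReal_ofReal (Real.exp_pos _).le]
  rw [← levyLaplace_I_mul]
  unfold levyLaplace
  rw [h6, eq_sub_of_add_eq h5.symm]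
  push_cast
  ring_nf

/-- The weight e^x is at most e on |x| ≤ 1, and outside it is integrable by assumption. -/
theorem IsLevyMeasure.withDensity_exp (hν : IsLevyMeasure ν)
    (hexp : IntegrableOn Real.exp {x | 1 < |x|} ν) :
    IsLevyMeasure (ν.withDensity fun x => ENNReal.ofReal (Real.exp x)) := by
  refine ⟨withDensity_absolutelyContinuous _ _ hν.zero, ?_⟩
  rw [lintegral_withDensity_eq_lintegral_mul _ (by fun_prop) (by fun_prop)]
  have h := (hν.integrable_compensatedExp_bound hexp (Real.exp 1)).2
  rw [hasFiniteIntegral_iff_ofReal (ae_of_all _ fun x => by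
    have : 0 ≤ {x : ℝ | 1 < |x|}.indicator Real.exp x :=
      Set.indicator_nonneg (fun x _ => (Real.exp_pos x).le) x
    positivity)] at h
  refine lt_of_le_of_lt (lintegral_mono fun x => ?_) h
  rw [Pi.mul_apply, ← ENNReal.ofReal_mul (Real.exp_pos x).le]
  refine ENNReal.ofReal_le_ofReal ?_
  by_cases hx : 1 < |x|
  · rw [Set.indicator_of_mem (s := {x : ℝ | 1 < |x|}) hx]
    have : min 1 (x ^ 2) ≤ 1 := min_le_left _ _
    have h0 : 0 ≤ min 1 (x ^ 2) := by positivity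
    have := mul_le_mul_of_nonneg_left this (Real.exp_pos x).le
    have := mul_nonneg (Real.exp_pos 1).le h0
    linarith
  · rw [Set.indicator_of_notMem (s := {x : ℝ | 1 < |x|}) hx, add_zero]
    have : x ≤ 1 := (le_abs_self x).trans (not_lt.1 hx)
    gcongr

end Tilting

/-! ### Translation to Lévy measures given by a density. -/

section Density

variable {ν : ℝ → ℝ}

theorem densityMeasure_tiltedDensity (hν : Measurable ν) :
    densityMeasure (tiltedDensity ν)
      = (densityMeasure ν).withDensity fun x => ENNReal.ofReal (Real.exp x) := by
  unfold densityMeasure tiltedDensity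
  rw [← withDensity_mul _ (by fun_prop) (by fun_prop)]
  congr 1
  ext x
  rw [Pi.mul_apply, ENNReal.ofReal_mul (Real.exp_pos x).le, mul_comm]

theorem integral_densityMeasure {E : Type*} [NormedAddCommGroup E] [NormedSpace ℝ E]
    (hν : Measurable ν) (hpos : ∀ x, x ≠ 0 → 0 < ν x) (g : ℝ → E) :
    ∫ x, g x ∂(densityMeasure ν) = ∫ x, ν x • g x := by
  unfold densityMeasure
  rw [integral_withDensity_eq_integral_toReal_smul (by fun_prop) (by simp)]
  refine integral_congr_ae ?_
  -- The value of ν at 0 is arbitrary, possibly negative, but sits on a Lebesgue null set.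
  have : ∀ᵐ x : ℝ, x ≠ 0 := by simp [ae_iff]
  filter_upwards [this] with x hx
  rw [ENNReal.toReal_ofReal (hpos x hx).le]

theorem integrableOn_exp_densityMeasure (hν : Measurable ν) (hpos : ∀ x, x ≠ 0 → 0 < ν x)
    (hexp : IntegrableOn (fun x => Real.exp x * ν x) {x | 1 < |x|}) :
    IntegrableOn Real.exp {x | 1 < |x|} (densityMeasure ν) := by
  have hs : MeasurableSet {x : ℝ | 1 < |x|} := measurableSet_lt (by fun_prop) (by fun_prop)
  unfold densityMeasure IntegrableOn
  rw [restrict_withDensity hs, integrable_withDensity_iff (by fun_prop) (by simp)]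
  refine IntegrableOn.congr_fun hexp (fun x hx => ?_) hs
  have hx : 1 < |x| := hx
  have : x ≠ 0 := by
    rintro rfl
    norm_num at hx
  rw [ENNReal.toReal_ofReal (hpos x this).le]

theorem levyLaplace_densityMeasure_one (hν : Measurable ν) (hpos : ∀ x, x ≠ 0 → 0 < ν x)
    {b σ : ℝ} (hmart : b + σ ^ 2 / 2 + ∫ x, (Real.exp x - 1 - smallJump x) * ν x = 0) :
    levyLaplace b (σ ^ 2) (densityMeasure ν) 1 = 0 := by
  unfold levyLaplace
  simp only [compensatedExp_one]
  rw [integral_complex_ofReal, integral_densityMeasure hν hpos]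
  simp only [smul_eq_mul, mul_comm (ν _)]
  rw [one_mul, one_pow, mul_one]
  exact_mod_cast hmart

theorem tiltedDrift_eq (hν : Measurable ν) (hpos : ∀ x, x ≠ 0 → 0 < ν x) (b σ : ℝ) :
    tiltedDrift b σ ν
      = b + (∫ x, smallJump x * (Real.exp x - 1) ∂(densityMeasure ν)) + σ ^ 2 := by
  unfold tiltedDrift
  rw [integral_densityMeasure hν hpos,
    ← integral_indicator (measurableSet_le (by fun_prop) (by fun_prop))]
  congr 3
  ext x
  by_cases hx : |x| ≤ 1
  · rw [Set.indicator_of_mem (s := {x : ℝ | |x| ≤ 1}) hx, smallJump, if_pos hx, smul_eq_mul]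
    ring
  · rw [Set.indicator_of_notMem (s := {x : ℝ | |x| ≤ 1}) hx, smallJump, if_neg hx]
    simp

theorem levyLaplace_densityMeasure_one_add (hν : Measurable ν) (hpos : ∀ x, x ≠ 0 → 0 < ν x)
    (hlevy : IsLevyMeasure (densityMeasure ν))
    (hexp : IntegrableOn (fun x => Real.exp x * ν x) {x | 1 < |x|}) {b σ : ℝ}
    (hmart : b + σ ^ 2 / 2 + ∫ x, (Real.exp x - 1 - smallJump x) * ν x = 0) (r : ℝ) :
    levyLaplace b (σ ^ 2) (densityMeasure ν) (1 + Complex.I * r)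
      = levyExponent (tiltedDrift b σ ν) (σ ^ 2) (densityMeasure (tiltedDensity ν)) r := by
  rw [tiltedDrift_eq hν hpos, densityMeasure_tiltedDensity hν, ← hlevy.levyLaplace_one_add_sub
    (integrableOn_exp_densityMeasure hν hpos hexp), levyLaplace_densityMeasure_one hν hpos hmart,
    sub_zero]

end Density

/-! ### Reduction to finite-dimensional distributions. -/

section FiniteDimensional

variable {Ω Ω' ι : Type*} [MeasurableSpace Ω] [MeasurableSpace Ω'] {E : Type*} [MeasurableSpace E]

theorem identDistrib_of_forall_finset_map_eq {P : Measure Ω} {P' : Measure Ω'} [IsFiniteMeasure P]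
    [IsFiniteMeasure P'] {Y : Ω → ι → E} {Y' : Ω' → ι → E} (hY : Measurable Y)
    (hY' : Measurable Y')
    (h : ∀ I : Finset ι, P.map (fun ω => I.restrict (Y ω)) = P'.map (fun ω => I.restrict (Y' ω))) :
    IdentDistrib Y Y' P P' := by
  refine ⟨hY.aemeasurable, hY'.aemeasurable, ?_⟩
  have h1 := isProjectiveLimit_map (X := fun i ω => Y ω i) (P := P) hY.aemeasurable
  have h2 := isProjectiveLimit_map (X := fun i ω => Y' ω i) (P := P') hY'.aemeasurable
  simp_rw [h] at h1
  exact h1.unique h2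

/-- Puts finitely many times in the shape required by `HasLevyIncrements`. The time 0 is inserted so
that values of the process are sums of increments, and the sequence is continued by r beyond the
list. -/
theorem exists_monotone_seq_of_finset (s : Finset ℝ≥0) {r : ℝ≥0} (hs : ∀ x ∈ s, x ≤ r) :
    ∃ (t : ℕ → ℝ≥0) (n : ℕ), Monotone t ∧ t 0 = 0 ∧ (∀ j, t j ≤ r) ∧
      ∀ x ∈ s, ∃ k ≤ n, t k = x := by
  classical
  set J := insert 0 s with hJ
  have hJr : ∀ x ∈ J, x ≤ r := by
    intro x hx
    rcases Finset.mem_insert.1 hx with rfl | hx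
    · exact zero_le
    · exact hs x hx
  have hcard : 0 < J.card := Finset.card_pos.2 ⟨0, Finset.mem_insert_self _ _⟩
  let t : ℕ → ℝ≥0 := fun j => if h : j < J.card then J.orderEmbOfFin rfl ⟨j, h⟩ else r
  refine ⟨t, J.card, ?_, ?_, ?_, ?_⟩
  · intro i j hij
    simp only [t]
    by_cases hj : j < J.card
    · rw [dif_pos hj, dif_pos (hij.trans_lt hj)]
      exact (J.orderEmbOfFin rfl).monotone hij
    · rw [dif_neg hj]
      split_ifs with hi
      · exact hJr _ (J.orderEmbOfFin_mem rfl _)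
      · exact le_rfl
  · simp only [t, dif_pos hcard]
    rw [Finset.orderEmbOfFin_zero rfl hcard]
    refine le_antisymm (Finset.min'_le _ _ (Finset.mem_insert_self _ _)) zero_le
  · intro j
    simp only [t]
    split_ifs with hj
    · exact hJr _ (J.orderEmbOfFin_mem rfl _)
    · exact le_rfl
  · intro x hx
    have : x ∈ Set.range (J.orderEmbOfFin rfl) := by
      rw [Finset.range_orderEmbOfFin]
      exact Finset.mem_coe.2 (Finset.mem_insert_of_mem hx)
    obtain ⟨k, rfl⟩ := this
    exact ⟨k, k.2.le, by simp only [t, dif_pos k.2]⟩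

end FiniteDimensional

/-! ### Independent stationary increments through joint characteristic functions. -/

section Increments

variable {Ω Ω' : Type*} [MeasurableSpace Ω] [MeasurableSpace Ω']

/-- Up to the horizon `r`, the increments of `X` under `Q` are independent and stationary with
characteristic exponent `ψ`, expressed through joint characteristic functions. -/
def HasLevyIncrements (X : ℝ≥0 → Ω → ℝ) (Q : Measure Ω) (r : ℝ≥0) (ψ : ℝ → ℂ) : Prop :=
  ∀ t : ℕ → ℝ≥0, Monotone t → (∀ j, t j ≤ r) → ∀ (n : ℕ) (α : ℕ → ℝ),
    ∫ ω, Complex.exp (∑ j ∈ Finset.range n,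
        Complex.I * α j * ((X (t (j + 1)) ω - X (t j) ω : ℝ) : ℂ)) ∂Q
      = Complex.exp (∑ j ∈ Finset.range n, (((t (j + 1) : ℝ) - t j : ℝ) : ℂ) * ψ (α j))

theorem IsLevyProcess.map_sub_eq {X : ℝ≥0 → Ω → ℝ} {P : Measure Ω} (hX : IsLevyProcess X P)
    {s t : ℝ≥0} (hst : s ≤ t) : P.map (fun ω => X t ω - X s ω) = P.map (X (t - s)) := by
  have h := (hX.stationary s (t - s)).map_eq
  rw [add_tsub_cancel_of_le hst] at h
  rw [h]
  refine Measure.map_congr ?_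
  filter_upwards [hX.zero] with ω hω
  rw [hω, sub_zero]

/-- Independence factorizes the integral and stationarity evaluates each factor. Complex z serves
both z = iα (the law itself) and z = 1 + iβ (the tilted law). -/
theorem IsLevyProcess.integral_cexp_sum {X : ℝ≥0 → Ω → ℝ} {P : Measure Ω}
    (hX : IsLevyProcess X P) {z w : ℕ → ℂ}
    (hzw : ∀ j (s : ℝ≥0), ∫ x : ℝ, Complex.exp (z j * x) ∂(P.map (X s))
      = Complex.exp (((s : ℝ) : ℂ) * w j))
    {t : ℕ → ℝ≥0} (ht : Monotone t) (n : ℕ) :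
    ∫ ω, Complex.exp (∑ j ∈ Finset.range n, z j * ((X (t (j + 1)) ω - X (t j) ω : ℝ) : ℂ)) ∂P
      = Complex.exp (∑ j ∈ Finset.range n, (((t (j + 1) : ℝ) - t j : ℝ) : ℂ) * w j) := by
  have hm := hX.measurable
  have hind : iIndepFun (fun (i : Fin n) ω => X (t (i + 1)) ω - X (t i) ω) P :=
    (hX.indep.nat ht).precomp Fin.val_injective
  have h := hind.integral_fun_prod_comp
    (f := fun (i : Fin n) (x : ℝ) => Complex.exp (z i * x)) (fun i => by fun_prop)
    (fun i => (measurable_cexp_mul _).aestronglyMeasurable)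
  simp only [Complex.exp_sum, Finset.prod_range]
  rw [h]
  refine Finset.prod_congr rfl fun i _ => ?_
  have hle : t i ≤ t (i + 1) := ht (Nat.le_succ _)
  rw [← integral_map (φ := fun ω => X (t (i + 1)) ω - X (t i) ω)
    (f := fun x : ℝ => Complex.exp (z i * x)) (by fun_prop)
    (measurable_cexp_mul _).aestronglyMeasurable, hX.map_sub_eq hle, hzw, NNReal.coe_sub hle]

theorem IsLevyProcessWithTriplet.hasLevyIncrements {X : ℝ≥0 → Ω → ℝ} {P : Measure Ω} {b a : ℝ}
    {ν : Measure ℝ} (hX : IsLevyProcessWithTriplet X P b a ν) (r : ℝ≥0) :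
    HasLevyIncrements X P r (levyExponent b a ν) := by
  intro t ht _ n α
  refine hX.levy.integral_cexp_sum (fun j s => ?_) ht n
  rw [← hX.charFun_eq, charFun_apply_real]
  congr 1
  ext x
  ring_nf

theorem measurable_ofReal_exp {X : ℝ≥0 → Ω → ℝ} (hX : ∀ t, Measurable (X t))
    (t : ℝ≥0) : Measurable fun ω => ENNReal.ofReal (Real.exp (X t ω)) :=
  (Real.measurable_exp.comp (hX t)).ennreal_ofReal

theorem integral_shareMeasure {Z : ℝ≥0 → Ω → ℝ} {P : Measure Ω} (hZ : ∀ t, Measurable (Z t))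
    (t : ℝ≥0) {E : Type*} [NormedAddCommGroup E] [NormedSpace ℝ E] (g : Ω → E) :
    ∫ ω, g ω ∂(shareMeasure P Z t) = ∫ ω, Real.exp (Z t ω) • g ω ∂P := by
  unfold shareMeasure
  rw [integral_withDensity_eq_integral_toReal_smul (measurable_ofReal_exp hZ t) (by simp)]
  simp only [ENNReal.toReal_ofReal (Real.exp_pos _).le]

theorem levyExponent_zero (b a : ℝ) (ν : Measure ℝ) : levyExponent b a ν 0 = 0 := by
  simp [levyExponent]

/-- The Esscher transform: under `e^{X_r} P` the increments up to time `r` are those of a Lévy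
process with exponent `ψ(u) = Ψ(1 + iu)`. -/
theorem IsLevyProcessWithTriplet.hasLevyIncrements_shareMeasure {X : ℝ≥0 → Ω → ℝ} {P : Measure Ω}
    [IsProbabilityMeasure P] {b a : ℝ} {ν : Measure ℝ} (hX : IsLevyProcessWithTriplet X P b a ν)
    (hexp : IntegrableOn Real.exp {x | 1 < |x|} ν) {ψ : ℝ → ℂ} (hψ0 : ψ 0 = 0)
    (hψ : ∀ u : ℝ, levyLaplace b a ν (1 + Complex.I * u) = ψ u) (r : ℝ≥0) :
    HasLevyIncrements X (shareMeasure P X r) r ψ := by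
  intro t ht htr n α
  -- The times are padded to 0, t_0, …, t_n, r, so that all increments sum to X_r. The density
  -- e^{X_r} then just adds 1 to each coefficient.
  obtain ⟨t', e0, e1, e2, ht'⟩ : ∃ t' : ℕ → ℝ≥0, t' 0 = 0 ∧ (∀ k ≤ n, t' (k + 1) = t k) ∧
      t' (n + 2) = r ∧ Monotone t' := by
    refine ⟨fun k => Nat.casesOn k 0 fun k => if k ≤ n then t k else r, rfl, fun k hk => if_pos hk,
      if_neg (by omega), monotone_nat_of_le_succ fun k => ?_⟩
    rcases k with _ | k
    · exact zero_le
    · simp only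
      split_ifs with h1 h2
      · exact ht (Nat.le_succ k)
      · exact htr k
      · omega
      · exact le_rfl
  -- The two added intervals get frequency 0, where ψ vanishes, so they drop out of the exponent.
  obtain ⟨β, f0, f1, f2⟩ : ∃ β : ℕ → ℝ, β 0 = 0 ∧ (∀ k < n, β (k + 1) = α k) ∧ β (n + 1) = 0 :=
    ⟨fun k => Nat.casesOn k 0 fun k => if k < n then α k else 0, rfl, fun k hk => if_pos hk,
      if_neg (by omega)⟩
  have h := hX.levy.integral_cexp_sum (z := fun j => 1 + Complex.I * β j) (w := fun j => ψ (β j))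
    (fun j s => by rw [← hψ]; exact (hX.integral_cexp_one_add hexp s).2 (β j)) ht' (n + 2)
  have hR : ∑ j ∈ Finset.range (n + 2), (((t' (j + 1) : ℝ) - t' j : ℝ) : ℂ) * ψ (β j)
      = ∑ j ∈ Finset.range n, (((t (j + 1) : ℝ) - t j : ℝ) : ℂ) * ψ (α j) := by
    rw [Finset.sum_range_succ, Finset.sum_range_succ', f0, f2, hψ0, mul_zero, mul_zero, add_zero,
      add_zero]
    refine Finset.sum_congr rfl fun j hj => ?_
    have hj := Finset.mem_range.1 hj
    rw [e1 j hj.le, e1 (j + 1) hj, f1 j hj]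
  rw [hR] at h
  rw [← h, integral_shareMeasure hX.levy.measurable]
  refine integral_congr_ae ?_
  filter_upwards [hX.levy.zero] with ω hω
  rw [Complex.real_smul, Complex.ofReal_exp, ← Complex.exp_add]
  congr 1
  have hsum : ∑ j ∈ Finset.range (n + 2), ((X (t' (j + 1)) ω - X (t' j) ω : ℝ) : ℂ)
      = (X r ω : ℂ) := by
    rw [← Complex.ofReal_sum, Finset.sum_range_sub (fun j => X (t' j) ω), e0, e2, hω, sub_zero]
  have hL : ∑ j ∈ Finset.range (n + 2), Complex.I * β j * ((X (t' (j + 1)) ω - X (t' j) ω : ℝ) : ℂ)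
      = ∑ j ∈ Finset.range n, Complex.I * α j * ((X (t (j + 1)) ω - X (t j) ω : ℝ) : ℂ) := by
    rw [Finset.sum_range_succ, Finset.sum_range_succ', f0, f2]
    simp only [Complex.ofReal_zero, mul_zero, zero_mul, add_zero]
    refine Finset.sum_congr rfl fun j hj => ?_
    have hj := Finset.mem_range.1 hj
    rw [e1 j hj.le, e1 (j + 1) hj, f1 j hj]
  simp only [add_mul, one_mul, Finset.sum_add_distrib]
  rw [hsum, hL]

/-- The case of no increments at all (n = 0) says that the total mass is 1. -/
theorem HasLevyIncrements.isProbabilityMeasure {X : ℝ≥0 → Ω → ℝ} {Q : Measure Ω} {r : ℝ≥0}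
    {ψ : ℝ → ℂ} (h : HasLevyIncrements X Q r ψ) : IsProbabilityMeasure Q := by
  have h0 := h (fun _ => 0) monotone_const (fun _ => zero_le) 0 0
  have h1 : Q.real Set.univ = 1 := by
    have : ((Q.real Set.univ : ℝ) : ℂ) = 1 := by simpa using h0
    exact_mod_cast this
  constructor
  rwa [Measure.real, ENNReal.toReal_eq_one_iff] at h1

/-- Summation by parts: a linear form in the values is a linear form in the increments, where
increment j collects the coefficients of all values taken after it. -/
theorem HasLevyIncrements.charFunDual_map {X : ℝ≥0 → Ω → ℝ} {Q : Measure Ω} {r : ℝ≥0} {ψ : ℝ → ℂ}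
    (h : HasLevyIncrements X Q r ψ) (hX : ∀ t, Measurable (X t)) (h0 : ∀ᵐ ω ∂Q, X 0 ω = 0)
    {κ : Type*} [Fintype κ] [DecidableEq κ] {t : ℕ → ℝ≥0} (ht : Monotone t) (ht0 : t 0 = 0)
    (htr : ∀ j, t j ≤ r) {n : ℕ} {k : κ → ℕ} (hkn : ∀ i, k i ≤ n) (L : StrongDual ℝ (κ → ℝ)) :
    charFunDual (Q.map fun ω i => X (t (k i)) ω) L
      = Complex.exp (∑ j ∈ Finset.range n, (((t (j + 1) : ℝ) - t j : ℝ) : ℂ)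
          * ψ (∑ i, if j < k i then L (Pi.single i 1) else 0)) := by
  have hL (x : κ → ℝ) : L x = ∑ i, L (Pi.single i 1) * x i := by
    conv_lhs => rw [pi_eq_sum_univ' x, map_sum]
    refine Finset.sum_congr rfl fun i _ => ?_
    rw [map_smul, smul_eq_mul, mul_comm]
  rw [← h t ht htr n, charFunDual_apply, integral_map (by fun_prop) (by fun_prop)]
  refine integral_congr_ae ?_
  filter_upwards [h0] with ω hω
  have key : L (fun i => X (t (k i)) ω) = ∑ j ∈ Finset.range n,
      (∑ i, if j < k i then L (Pi.single i 1) else 0) * (X (t (j + 1)) ω - X (t j) ω) := by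
    rw [hL]
    simp only [Finset.sum_mul]
    rw [Finset.sum_comm]
    refine Finset.sum_congr rfl fun i _ => ?_
    have : X (t (k i)) ω = ∑ j ∈ Finset.range (k i), (X (t (j + 1)) ω - X (t j) ω) := by
      rw [Finset.sum_range_sub (fun j => X (t j) ω), ht0, hω, sub_zero]
    rw [this, Finset.mul_sum]
    simp only [ite_mul, zero_mul]
    rw [← Finset.sum_filter]
    refine Finset.sum_congr ?_ fun _ _ => rfl
    ext j
    have := hkn i
    simp only [Finset.mem_range, Finset.mem_filter]
    omega
  rw [key, Complex.ofReal_sum, Finset.sum_mul]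
  congr 1
  refine Finset.sum_congr rfl fun j _ => ?_
  push_cast
  ring

/-- Increments with the same exponent determine the law of a process started at `0`. -/
theorem HasLevyIncrements.identDistrib {X : ℝ≥0 → Ω → ℝ} {Q : Measure Ω} {X' : ℝ≥0 → Ω' → ℝ}
    {Q' : Measure Ω'} {r : ℝ≥0} {ψ : ℝ → ℂ} (h : HasLevyIncrements X Q r ψ)
    (h' : HasLevyIncrements X' Q' r ψ) (hX : ∀ t, Measurable (X t)) (hX' : ∀ t, Measurable (X' t))
    (h0 : ∀ᵐ ω ∂Q, X 0 ω = 0) (h0' : ∀ᵐ ω ∂Q', X' 0 ω = 0) {ι : Type*} {s : ι → ℝ≥0}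
    (hs : ∀ i, s i ≤ r) :
    IdentDistrib (fun ω i => X (s i) ω) (fun ω i => X' (s i) ω) Q Q' := by
  classical
  have := h.isProbabilityMeasure
  have := h'.isProbabilityMeasure
  refine identDistrib_of_forall_finset_map_eq (by fun_prop) (by fun_prop) fun I => ?_
  -- Different indices may carry the same time, so the image is enumerated and each index points to
  -- its place in it.
  obtain ⟨t, n, ht, ht0, htr, hk⟩ := exists_monotone_seq_of_finset (I.image s) (r := r) (by
    intro x hx
    obtain ⟨i, -, rfl⟩ := Finset.mem_image.1 hx
    exact hs i)
  choose k hkn hk using fun i : I => hk (s i) (Finset.mem_image_of_mem s i.2)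
  refine Measure.ext_of_charFunDual (funext fun L => ?_)
  have e1 := h.charFunDual_map hX h0 ht ht0 htr hkn L
  have e2 := h'.charFunDual_map hX' h0' ht ht0 htr hkn L
  simp only [hk] at e1 e2
  exact e1.trans e2.symm

theorem HasLevyIncrements.charFun_map_sub {X : ℝ≥0 → Ω → ℝ} {Q : Measure Ω} {r : ℝ≥0} {ψ : ℝ → ℂ}
    (h : HasLevyIncrements X Q r ψ) (hX : ∀ t, Measurable (X t)) {s t : ℝ≥0} (hst : s ≤ t)
    (htr : t ≤ r) (u : ℝ) :
    charFun (Q.map fun ω => X t ω - X s ω) u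
      = Complex.exp ((((t : ℝ) - s : ℝ) : ℂ) * ψ u) := by
  have h1 := h (fun k => if k = 0 then s else t)
    (monotone_nat_of_le_succ fun k => by
      by_cases hk : k = 0
      · simpa [hk] using hst
      · simp [hk])
    (fun j => by
      split_ifs
      · exact hst.trans htr
      · exact htr) 1 (fun _ => u)
  simp only [Finset.sum_range_one, zero_add, if_true, one_ne_zero, if_false] at h1
  rw [← h1, charFun_apply_real, integral_map (by fun_prop) (by fun_prop)]
  congr 1
  ext ω
  ring_nf

theorem hasIndepIncrements_of_hasLevyIncrements {X : ℝ≥0 → Ω → ℝ} {Q : Measure Ω} {ψ : ℝ → ℂ}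
    (h : ∀ r, HasLevyIncrements X Q r ψ) (hX : ∀ t, Measurable (X t)) :
    HasIndepIncrements X Q := by
  have := (h 0).isProbabilityMeasure
  intro n t ht
  rw [iIndepFun_iff_charFun_pi (fun i => by fun_prop)]
  intro v
  -- The finite list of times is continued by its last value, keeping it monotone.
  let t' : ℕ → ℝ≥0 := fun k => t ⟨min n k, by omega⟩
  let α : ℕ → ℝ := fun k => if hk : k < n then v ⟨k, hk⟩ else 0
  have ht' : Monotone t' := fun i j hij => ht (by
    rw [Fin.mk_le_mk]
    exact min_le_min_left n hij)
  have hαv (i : Fin n) : α i = v i := dif_pos i.2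
  have hs (i : Fin n) : t' (i + 1) = t i.succ := by
    simp only [t']
    congr 1
    ext
    simp only [Fin.val_succ]
    omega
  have hc (i : Fin n) : t' i = t i.castSucc := by
    simp only [t']
    congr 1
    ext
    simp only [Fin.val_castSucc]
    omega
  have h1 := h (t (Fin.last n)) t' ht' (fun j => ht (Fin.le_last _)) n α
  simp only [Finset.sum_range] at h1
  simp only [hαv, hs, hc] at h1
  have h2 (i : Fin n) := (h (t i.succ)).charFun_map_sub hX (ht (Fin.castSucc_le_succ i)) le_rfl
    (v i)
  simp only [h2]
  rw [← Complex.exp_sum, ← h1, charFun_apply, integral_map (by fun_prop) (by fun_prop)]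
  congr 1
  ext ω
  rw [PiLp.inner_apply, Complex.ofReal_sum, Finset.sum_mul]
  congr 1
  refine Finset.sum_congr rfl fun i _ => ?_
  simp only [RCLike.inner_apply, conj_trivial]
  push_cast
  ring

theorem isLevyProcess_of_hasLevyIncrements {X : ℝ≥0 → Ω → ℝ} {Q : Measure Ω} {ψ : ℝ → ℂ}
    (h : ∀ r, HasLevyIncrements X Q r ψ) (hX : ∀ t, Measurable (X t)) (h0 : ∀ᵐ ω ∂Q, X 0 ω = 0)
    (hright : ∀ ω t, ContinuousWithinAt (fun s => X s ω) (Set.Ici t) t)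
    (hleft : ∀ ω t, ∃ l : ℝ, Tendsto (fun s => X s ω) (𝓝[<] t) (𝓝 l)) :
    IsLevyProcess X Q := by
  have := (h 0).isProbabilityMeasure
  refine ⟨hX, h0, hasIndepIncrements_of_hasLevyIncrements h hX, fun s t => ?_, hright, hleft⟩
  refine ⟨by fun_prop, by fun_prop, Measure.ext_of_charFun (funext fun u => ?_)⟩
  rw [(h (s + t)).charFun_map_sub hX le_self_add le_rfl,
    (h t).charFun_map_sub hX zero_le le_rfl]
  push_cast
  ring_nf

theorem HasLevyIncrements.charFun_map {X : ℝ≥0 → Ω → ℝ} {Q : Measure Ω} {t : ℝ≥0} {ψ : ℝ → ℂ}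
    (h : HasLevyIncrements X Q t ψ) (hX : ∀ t, Measurable (X t)) (h0 : ∀ᵐ ω ∂Q, X 0 ω = 0)
    (u : ℝ) : charFun (Q.map (X t)) u = Complex.exp (((t : ℝ) : ℂ) * ψ u) := by
  have h1 := h.charFun_map_sub hX zero_le le_rfl u
  rw [NNReal.coe_zero, sub_zero] at h1
  rw [← h1]
  congr 1
  refine Measure.map_congr ?_
  filter_upwards [h0] with ω hω
  rw [hω, sub_zero]

end Increments

/-! ### Construction of a Lévy process from independent unit pieces. -/

section Concatenation

/-- The time spent in the interval `[k, k + 1]` up to time `t`. -/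
noncomputable def unitClamp (k : ℕ) (t : ℝ≥0) : ℝ≥0 := min (t - k) 1

theorem monotone_unitClamp (k : ℕ) : Monotone (unitClamp k) := fun _ _ h =>
  min_le_min_right 1 (tsub_le_tsub_right h _)

theorem continuous_unitClamp (k : ℕ) : Continuous (unitClamp k) := by
  unfold unitClamp
  fun_prop

theorem unitClamp_le_one (k : ℕ) (t : ℝ≥0) : unitClamp k t ≤ 1 := min_le_right _ _

theorem unitClamp_of_le {k : ℕ} {t : ℝ≥0} (h : t ≤ k) : unitClamp k t = 0 := by
  rw [unitClamp, tsub_eq_zero_of_le h, min_eq_left zero_le]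

theorem sum_unitClamp (N : ℕ) (t : ℝ≥0) :
    ∑ k ∈ Finset.range N, unitClamp k t = min t N := by
  induction N with
  | zero => simp
  | succ N ih =>
    rw [Finset.sum_range_succ, ih, unitClamp]
    rcases le_total t N with h | h
    · rw [min_eq_left h, tsub_eq_zero_of_le h, min_eq_left zero_le, add_zero,
        min_eq_left (h.trans (by simp))]
    · obtain ⟨d, rfl⟩ := exists_add_of_le h
      rw [min_eq_right le_self_add, add_tsub_cancel_left, Nat.cast_succ, min_add_add_left]

variable {Ω : Type*}

/-- The process obtained by running the increments over `[0, 1]` of a sequence of copies of `X` one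
after the other. -/
noncomputable def concatPath (X : ℝ≥0 → Ω → ℝ) (t : ℝ≥0) (ω : ℕ → Ω) : ℝ :=
  ∑ k ∈ Finset.range ⌈t⌉₊, (X (unitClamp k t) (ω k) - X 0 (ω k))

/-- Pieces that start after t contribute zero, so any common upper limit N can replace ⌈t⌉. -/
theorem concatPath_eq_sum (X : ℝ≥0 → Ω → ℝ) {t : ℝ≥0} {N : ℕ} (h : t ≤ N) (ω : ℕ → Ω) :
    concatPath X t ω = ∑ k ∈ Finset.range N, (X (unitClamp k t) (ω k) - X 0 (ω k)) := by
  refine Finset.sum_subset (Finset.range_mono (Nat.ceil_le.2 h)) fun k _ hk => ?_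
  rw [Finset.mem_range, not_lt] at hk
  rw [unitClamp_of_le (Nat.ceil_le.1 hk), sub_self]

theorem concatPath_zero (X : ℝ≥0 → Ω → ℝ) (ω : ℕ → Ω) : concatPath X 0 ω = 0 := by
  simp [concatPath]

theorem measurable_concatPath [MeasurableSpace Ω] {X : ℝ≥0 → Ω → ℝ}
    (hX : ∀ t, Measurable (X t)) (t : ℝ≥0) : Measurable (concatPath X t) := by
  unfold concatPath
  fun_prop

/-- Locally in time the path is one fixed finite sum, so right-continuity and left limits can be
checked term by term. -/
theorem concatPath_eventuallyEq (X : ℝ≥0 → Ω → ℝ) (t : ℝ≥0) (ω : ℕ → Ω) :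
    (fun s => concatPath X s ω) =ᶠ[𝓝 t] fun s => ∑ k ∈ Finset.range (⌈t⌉₊ + 1),
      (X (unitClamp k s) (ω k) - X 0 (ω k)) := by
  have h : t < (⌈t⌉₊ + 1 : ℕ) := (Nat.le_ceil t).trans_lt (by exact_mod_cast Nat.lt_succ_self _)
  filter_upwards [gt_mem_nhds h] with s hs
  exact concatPath_eq_sum X hs.le ω

theorem continuousWithinAt_concatPath {X : ℝ≥0 → Ω → ℝ}
    (hX : ∀ ω t, ContinuousWithinAt (fun s => X s ω) (Set.Ici t) t) (ω : ℕ → Ω) (t : ℝ≥0) :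
    ContinuousWithinAt (fun s => concatPath X s ω) (Set.Ici t) t := by
  refine ContinuousWithinAt.congr_of_eventuallyEq ?_
    ((concatPath_eventuallyEq X t ω).filter_mono nhdsWithin_le_nhds)
    (concatPath_eventuallyEq X t ω).self_of_nhds
  refine tendsto_finsetSum _ fun k _ => Tendsto.sub_const ?_ _
  exact (hX (ω k) (unitClamp k t)).comp (continuous_unitClamp k).continuousWithinAt
    fun s hs => monotone_unitClamp k hs

/-- Either φ is constant just to the left of t, or it approaches φ(t) strictly from below; the left
limit exists in both cases. -/
theorem exists_tendsto_left_comp_monotone {f : ℝ≥0 → ℝ} {φ : ℝ≥0 → ℝ≥0} (hφ : Monotone φ)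
    (hφc : Continuous φ) (hf : ∀ t, ∃ l : ℝ, Tendsto f (𝓝[<] t) (𝓝 l)) (t : ℝ≥0) :
    ∃ l : ℝ, Tendsto (fun s => f (φ s)) (𝓝[<] t) (𝓝 l) := by
  by_cases h : ∃ s < t, φ s = φ t
  · obtain ⟨s, hs, hst⟩ := h
    refine ⟨f (φ t), tendsto_const_nhds.congr' ?_⟩
    filter_upwards [Ioo_mem_nhdsLT hs] with x hx
    have : φ x = φ t := le_antisymm (hφ hx.2.le) (hst ▸ hφ hx.1.le)
    rw [this]
  · push Not at h
    obtain ⟨l, hl⟩ := hf (φ t)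
    refine ⟨l, hl.comp ?_⟩
    refine tendsto_nhdsWithin_iff.2 ⟨(hφc.tendsto t).mono_left nhdsWithin_le_nhds, ?_⟩
    filter_upwards [self_mem_nhdsWithin] with s hs
    exact lt_of_le_of_ne (hφ (le_of_lt hs)) (h s hs)

theorem exists_tendsto_left_concatPath {X : ℝ≥0 → Ω → ℝ}
    (hX : ∀ ω t, ∃ l : ℝ, Tendsto (fun s => X s ω) (𝓝[<] t) (𝓝 l)) (ω : ℕ → Ω) (t : ℝ≥0) :
    ∃ l : ℝ, Tendsto (fun s => concatPath X s ω) (𝓝[<] t) (𝓝 l) := by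
  choose l hl using fun k => exists_tendsto_left_comp_monotone (monotone_unitClamp k)
    (continuous_unitClamp k) (hX (ω k)) t
  refine ⟨∑ k ∈ Finset.range (⌈t⌉₊ + 1), (l k - X 0 (ω k)), Tendsto.congr'
    ((concatPath_eventuallyEq X t ω).filter_mono nhdsWithin_le_nhds).symm ?_⟩
  exact tendsto_finsetSum _ fun k _ => (hl k).sub_const _

/-- Each increment splits into increments of the independent copies between clamped times. The
integral factorizes over the copies, horizon 1 suffices for each, and the clamped lengths add up to
t_{j+1} - t_j. -/
theorem HasLevyIncrements.concatPath [MeasurableSpace Ω] {X : ℝ≥0 → Ω → ℝ} {Q : Measure Ω}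
    [IsProbabilityMeasure Q] {ψ : ℝ → ℂ} (h : HasLevyIncrements X Q 1 ψ)
    (hX : ∀ t, Measurable (X t)) (r : ℝ≥0) :
    HasLevyIncrements (concatPath X) (Measure.infinitePi fun _ : ℕ => Q) r ψ := by
  intro t ht htr n α
  set N := ⌈r⌉₊
  have htN (j : ℕ) : t j ≤ N := (htr j).trans (Nat.le_ceil r)
  let g : ℕ → Ω → ℂ := fun k ω => Complex.exp (∑ j ∈ Finset.range n,
    Complex.I * α j * ((X (unitClamp k (t (j + 1))) ω - X (unitClamp k (t j)) ω : ℝ) : ℂ))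
  have hg (k : ℕ) : Measurable (g k) := by
    simp only [g]
    fun_prop
  have hind : iIndepFun (fun (k : Fin N) (ω : ℕ → Ω) => g k (ω k))
      (Measure.infinitePi fun _ : ℕ => Q) :=
    (iIndepFun_infinitePi (P := fun _ : ℕ => Q) hg).precomp Fin.val_injective
  have hint (k : ℕ) : ∫ ω : ℕ → Ω, g k (ω k) ∂(Measure.infinitePi fun _ : ℕ => Q)
      = Complex.exp (∑ j ∈ Finset.range n,
        (((unitClamp k (t (j + 1)) : ℝ) - unitClamp k (t j) : ℝ) : ℂ) * ψ (α j)) := by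
    have hmp := measurePreserving_eval_infinitePi (fun _ : ℕ => Q) k
    have hmap := integral_map (μ := Measure.infinitePi fun _ : ℕ => Q) (f := g k)
      hmp.measurable.aemeasurable (hg k).aestronglyMeasurable
    rw [hmp.map_eq] at hmap
    exact hmap.symm.trans (h (fun j => unitClamp k (t j)) ((monotone_unitClamp k).comp ht)
      (fun j => unitClamp_le_one k _) n α)
  have hprod := hind.integral_fun_prod_eq_prod_integral
    (fun k => ((hg k).comp (measurable_pi_apply _)).aestronglyMeasurable)
  simp only [hint] at hprod
  have hclamp (s : ℝ≥0) (hs : s ≤ N) : (s : ℝ) = ∑ k ∈ Finset.range N, (unitClamp k s : ℝ) := by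
    rw [← NNReal.coe_sum, sum_unitClamp, min_eq_left hs]
  calc _ = ∫ ω : ℕ → Ω, ∏ k : Fin N, g k (ω k) ∂(Measure.infinitePi fun _ : ℕ => Q) := by
        congr 1
        ext ω
        rw [← Finset.prod_range (fun k => g k (ω k)), ← Complex.exp_sum, Finset.sum_comm]
        congr 1
        refine Finset.sum_congr rfl fun j _ => ?_
        rw [concatPath_eq_sum X (htN _), concatPath_eq_sum X (htN _), ← Finset.mul_sum,
          ← Finset.sum_sub_distrib, Complex.ofReal_sum]
        simp only [sub_sub_sub_cancel_right]
    _ = _ := by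
        rw [hprod, ← Complex.exp_sum,
          ← Finset.sum_range (fun k => ∑ j ∈ Finset.range n,
            (((unitClamp k (t (j + 1)) : ℝ) - unitClamp k (t j) : ℝ) : ℂ) * ψ (α j)),
          Finset.sum_comm]
        congr 1
        refine Finset.sum_congr rfl fun j _ => ?_
        rw [← Finset.sum_mul, ← Complex.ofReal_sum, Finset.sum_sub_distrib, ← hclamp _ (htN _),
          ← hclamp _ (htN _)]

theorem HasLevyIncrements.comp_measurePreserving {Ω' : Type*} [MeasurableSpace Ω]
    [MeasurableSpace Ω'] {X : ℝ≥0 → Ω → ℝ} {Q : Measure Ω} {r : ℝ≥0} {ψ : ℝ → ℂ}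
    (h : HasLevyIncrements X Q r ψ) (hX : ∀ t, Measurable (X t)) {Q' : Measure Ω'} {f : Ω' → Ω}
    (hf : MeasurePreserving f Q' Q) : HasLevyIncrements (fun t ω => X t (f ω)) Q' r ψ := by
  intro t ht htr n α
  rw [← h t ht htr n α, ← hf.map_eq, integral_map hf.measurable.aemeasurable
    (Measurable.aestronglyMeasurable (by fun_prop))]

/-- If the increments of `X` over `[0, 1]` under some measure are those of a Lévy process with a
given triplet, then such a Lévy process exists, jointly with an independent copy of any clock. -/
theorem exists_isLevyWithIndepClock {Ω : Type u} [MeasurableSpace Ω] {P Q : Measure Ω}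
    [IsProbabilityMeasure P] {X : ℝ≥0 → Ω → ℝ} {T : ℝ≥0 → Ω → ℝ≥0} {b a : ℝ} {ν : Measure ℝ}
    (hX : ∀ t, Measurable (X t))
    (hright : ∀ ω t, ContinuousWithinAt (fun s => X s ω) (Set.Ici t) t)
    (hleft : ∀ ω t, ∃ l : ℝ, Tendsto (fun s => X s ω) (𝓝[<] t) (𝓝 l))
    (hT : IsRandomClock T) (ha : 0 ≤ a) (hν : IsLevyMeasure ν)
    (h : HasLevyIncrements X Q 1 (levyExponent b a ν)) :
    ∃ (Ω' : Type u) (_ : MeasurableSpace Ω') (P' : Measure Ω')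
      (X' : ℝ≥0 → Ω' → ℝ) (T' : ℝ≥0 → Ω' → ℝ≥0), IsProbabilityMeasure P' ∧
      IsLevyWithIndepClock X' T' P' b a ν ∧
      IdentDistrib (fun ω t => T' t ω) (fun ω t => T t ω) P' P := by
  have := h.isProbabilityMeasure
  have hTm := hT.measurable
  have hXm := measurable_concatPath hX
  -- The first factor carries the copies of X, with the original paths and hence their regularity;
  -- the second carries the clock with its original law.
  let M := (Measure.infinitePi fun _ : ℕ => Q).prod P
  have hinc (r : ℝ≥0) : HasLevyIncrements (fun t (ω : (ℕ → Ω) × Ω) => concatPath X t ω.1) M r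
      (levyExponent b a ν) :=
    (h.concatPath hX r).comp_measurePreserving hXm measurePreserving_fst
  have hm (t : ℝ≥0) : Measurable fun ω : (ℕ → Ω) × Ω => concatPath X t ω.1 :=
    (hXm t).comp measurable_fst
  have hzero : ∀ᵐ ω ∂M, concatPath X 0 ω.1 = 0 := ae_of_all _ fun ω => concatPath_zero X _
  refine ⟨(ℕ → Ω) × Ω, inferInstance, M, fun t ω => concatPath X t ω.1, fun t ω => T t ω.2,
    inferInstance, ⟨⟨?_, ha, hν, fun t u => (hinc t).charFun_map hm hzero u⟩, ?_, ?_⟩, ?_⟩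
  · exact isLevyProcess_of_hasLevyIncrements hinc hm hzero
      (fun ω => continuousWithinAt_concatPath hright ω.1)
      (fun ω => exists_tendsto_left_concatPath hleft ω.1)
  · exact ⟨fun t => (hTm t).comp measurable_snd, fun ω => hT.zero _, fun ω => hT.mono _,
      fun ω => hT.rightCont _⟩
  · exact indepFun_prod (X := fun (ω : ℕ → Ω) t => concatPath X t ω)
      (Y := fun (ω : Ω) t => T t ω) (by fun_prop) (by fun_prop)
  · have hTp : Measurable fun ω t => T t ω := measurable_pi_iff.2 hTm
    refine ⟨(hTp.comp measurable_snd).aemeasurable, hTp.aemeasurable, ?_⟩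
    rw [← (measurePreserving_snd (μ := Measure.infinitePi fun _ : ℕ => Q) (ν := P)).map_eq,
      Measure.map_map hTp measurable_snd]
    rfl

end Concatenation

/-! ### Evaluation at an independent random clock. -/

section TimeChange

/-- The approximation of a time from the right on the grid of mesh `1 / (k + 1)`. -/
noncomputable def gridTime (k m : ℕ) : ℝ≥0 := ((m : ℝ≥0) + 1) / (k + 1)

/-- The +1 in the numerator puts the grid point on the right of u, within 1/(k+1); paths are only
right-continuous. -/
theorem tendsto_gridTime (u : ℝ≥0) :
    Tendsto (fun k : ℕ => gridTime k ⌊((k : ℝ≥0) + 1) * u⌋₊) atTop (𝓝[≥] u) := by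
  have hlow (k : ℕ) : u ≤ gridTime k ⌊((k : ℝ≥0) + 1) * u⌋₊ := by
    rw [gridTime, le_div_iff₀ (by positivity), mul_comm]
    exact (Nat.lt_floor_add_one _).le
  have hupp (k : ℕ) : gridTime k ⌊((k : ℝ≥0) + 1) * u⌋₊ ≤ u + 1 / ((k : ℝ≥0) + 1) := by
    have : (0 : ℝ≥0) < (k : ℝ≥0) + 1 := by positivity
    rw [gridTime, add_div]
    gcongr
    rw [div_le_iff₀ this, mul_comm u]
    exact Nat.floor_le zero_le
  refine tendsto_nhdsWithin_iff.2 ⟨?_, Eventually.of_forall hlow⟩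
  refine tendsto_of_tendsto_of_tendsto_of_le_of_le tendsto_const_nhds ?_ hlow hupp
  have : Tendsto (fun k : ℕ => 1 / ((k : ℝ≥0) + 1)) atTop (𝓝 0) :=
    tendsto_one_div_add_atTop_nhds_zero_nat
  simpa using this.const_add u

/-- The pair of a path evaluated along a discretized clock, and that clock. -/
noncomputable def gridTimeChange (k : ℕ) (p : (ℝ≥0 → ℝ) × (ℝ≥0 → ℝ≥0)) (s : ℝ≥0) : ℝ × ℝ≥0 :=
  (p.1 (gridTime k ⌊((k : ℝ≥0) + 1) * p.2 s⌋₊), p.2 s)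

/-- Evaluation at a random time is not measurable on the full path space with its product σ-algebra;
on a grid only countably many times occur. -/
theorem measurable_gridTimeChange (k : ℕ) : Measurable (gridTimeChange k) := by
  refine measurable_pi_iff.2 fun s => Measurable.prodMk ?_ (by fun_prop)
  have h1 : Measurable fun q : (ℝ≥0 → ℝ) × ℕ => q.1 (gridTime k q.2) :=
    measurable_from_prod_countable_left fun m =>
      measurable_pi_apply (X := fun _ : ℝ≥0 => ℝ) (gridTime k m)
  have h2 : Measurable fun p : (ℝ≥0 → ℝ) × (ℝ≥0 → ℝ≥0) => (p.1, ⌊((k : ℝ≥0) + 1) * p.2 s⌋₊) :=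
    measurable_fst.prodMk (Nat.measurable_floor.comp (by fun_prop))
  exact h1.comp h2

variable {Ω Ω' : Type*}

theorem tendsto_gridTimeChange {X : ℝ≥0 → Ω → ℝ} {T : ℝ≥0 → Ω → ℝ≥0}
    (hX : ∀ ω t, ContinuousWithinAt (fun s => X s ω) (Set.Ici t) t) (ω : Ω) (s : ℝ≥0) :
    Tendsto (fun k => gridTimeChange k (fun t => X t ω, fun t => T t ω) s) atTop
      (𝓝 (timeChange X T s ω, T s ω)) :=
  Tendsto.prodMk_nhds (Tendsto.comp (hX ω (T s ω)) (tendsto_gridTime (T s ω))) tendsto_const_nhds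

variable [MeasurableSpace Ω] [MeasurableSpace Ω']

theorem measurable_timeChange {X : ℝ≥0 → Ω → ℝ} {T : ℝ≥0 → Ω → ℝ≥0}
    (hXm : ∀ t, Measurable (X t)) (hTm : ∀ t, Measurable (T t))
    (hX : ∀ ω t, ContinuousWithinAt (fun s => X s ω) (Set.Ici t) t) (s : ℝ≥0) :
    Measurable (timeChange X T s) := by
  have h : Measurable fun ω => (timeChange X T s ω, T s ω) := by
    refine measurable_of_tendsto_metrizable
      (f := fun k ω => gridTimeChange k (fun t => X t ω, fun t => T t ω) s) (fun k => ?_)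
      (tendsto_pi_nhds.2 fun ω => tendsto_gridTimeChange hX ω s)
    exact (measurable_pi_apply s).comp ((measurable_gridTimeChange k).comp (by fun_prop))
  exact measurable_fst.comp h

/-- The law of a right-continuous process evaluated at random times, jointly with these times, is
determined by the joint law of the process and the times. -/
theorem identDistrib_timeChange {P : Measure Ω} {P' : Measure Ω'} [IsProbabilityMeasure P]
    [IsProbabilityMeasure P'] {X : ℝ≥0 → Ω → ℝ} {T : ℝ≥0 → Ω → ℝ≥0} {X' : ℝ≥0 → Ω' → ℝ}
    {T' : ℝ≥0 → Ω' → ℝ≥0} (hXm : ∀ t, Measurable (X t)) (hTm : ∀ t, Measurable (T t))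
    (hX : ∀ ω t, ContinuousWithinAt (fun s => X s ω) (Set.Ici t) t)
    (hXm' : ∀ t, Measurable (X' t)) (hTm' : ∀ t, Measurable (T' t))
    (hX' : ∀ ω t, ContinuousWithinAt (fun s => X' s ω) (Set.Ici t) t)
    (h : IdentDistrib (fun ω => ((fun t => X t ω), fun t => T t ω))
      (fun ω => ((fun t => X' t ω), fun t => T' t ω)) P P') :
    IdentDistrib (fun ω s => (timeChange X T s ω, T s ω))
      (fun ω s => (timeChange X' T' s ω, T' s ω)) P P' := by
  have hZ := measurable_timeChange hXm hTm hX
  have hZ' := measurable_timeChange hXm' hTm' hX'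
  have hW : Measurable fun ω s => (timeChange X T s ω, T s ω) :=
    measurable_pi_iff.2 fun s => (hZ s).prodMk (hTm s)
  have hW' : Measurable fun ω s => (timeChange X' T' s ω, T' s ω) :=
    measurable_pi_iff.2 fun s => (hZ' s).prodMk (hTm' s)
  refine identDistrib_of_forall_finset_map_eq hW hW' fun I => ?_
  have hWI : Measurable fun ω => I.restrict fun s => (timeChange X T s ω, T s ω) :=
    (Finset.measurable_restrict I).comp hW
  have hWI' : Measurable fun ω => I.restrict fun s => (timeChange X' T' s ω, T' s ω) :=
    (Finset.measurable_restrict I).comp hW'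
  have := Measure.isProbabilityMeasure_map (μ := P) hWI.aemeasurable
  have := Measure.isProbabilityMeasure_map (μ := P') hWI'.aemeasurable
  refine ext_of_forall_integral_eq_of_IsFiniteMeasure fun f => ?_
  have hf : Measurable f := f.continuous.measurable
  -- Discretized functionals are measurable in the pair of paths, so their expectations agree for
  -- each k; right-continuity and bounded convergence carry this to the limit.
  have hu (k : ℕ) : Measurable fun p => f (I.restrict (gridTimeChange k p)) :=
    hf.comp ((Finset.measurable_restrict I).comp (measurable_gridTimeChange k))
  rw [integral_map hWI.aemeasurable hf.aestronglyMeasurable,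
    integral_map hWI'.aemeasurable hf.aestronglyMeasurable]
  have t1 : Tendsto (fun k => ∫ ω, f (I.restrict
      (gridTimeChange k (fun t => X t ω, fun t => T t ω))) ∂P) atTop
      (𝓝 (∫ ω, f (I.restrict fun s => (timeChange X T s ω, T s ω)) ∂P)) := by
    refine tendsto_integral_of_dominated_convergence (fun _ => ‖f‖)
      (fun k => ((hu k).comp (by fun_prop)).aestronglyMeasurable) (integrable_const _)
      (fun k => ae_of_all _ fun ω => f.norm_coe_le_norm _) (ae_of_all _ fun ω => ?_)
    exact (f.continuous.tendsto _).comp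
      (tendsto_pi_nhds.2 fun s => tendsto_gridTimeChange hX ω s)
  have t2 : Tendsto (fun k => ∫ ω, f (I.restrict
      (gridTimeChange k (fun t => X' t ω, fun t => T' t ω))) ∂P') atTop
      (𝓝 (∫ ω, f (I.restrict fun s => (timeChange X' T' s ω, T' s ω)) ∂P')) := by
    refine tendsto_integral_of_dominated_convergence (fun _ => ‖f‖)
      (fun k => ((hu k).comp (by fun_prop)).aestronglyMeasurable) (integrable_const _)
      (fun k => ae_of_all _ fun ω => f.norm_coe_le_norm _) (ae_of_all _ fun ω => ?_)
    exact (f.continuous.tendsto _).comp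
      (tendsto_pi_nhds.2 fun s => tendsto_gridTimeChange hX' ω s)
  refine tendsto_nhds_unique t1 (t2.congr fun k => ?_)
  exact ((h.comp (hu k)).integral_eq).symm

/-- A process and an independent clock have the joint law of a process and a clock living on the
two factors of a product space. -/
theorem identDistrib_timeChange_prod {P : Measure Ω} {P' : Measure Ω'} [IsProbabilityMeasure P]
    [IsProbabilityMeasure P'] {T : ℝ≥0 → Ω → ℝ≥0} {X' : ℝ≥0 → Ω' → ℝ}
    {T' : ℝ≥0 → Ω' → ℝ≥0} (hTm : ∀ t, Measurable (T t))
    (hXm' : ∀ t, Measurable (X' t)) (hTm' : ∀ t, Measurable (T' t))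
    (hX' : ∀ ω t, ContinuousWithinAt (fun s => X' s ω) (Set.Ici t) t)
    (hind : IndepFun (fun ω t => X' t ω) (fun ω t => T' t ω) P')
    (hT : IdentDistrib (fun ω t => T' t ω) (fun ω t => T t ω) P' P) :
    IdentDistrib (fun ω s => (timeChange X' T' s ω, T' s ω))
      (fun (ω : Ω' × Ω) s => (X' (T s ω.2) ω.1, T s ω.2)) P' (P'.prod P) := by
  refine identDistrib_timeChange (X' := fun t (ω : Ω' × Ω) => X' t ω.1)
    (T' := fun t (ω : Ω' × Ω) => T t ω.2) hXm' hTm' hX' (by fun_prop) (by fun_prop)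
    (fun ω => hX' ω.1) ⟨by fun_prop, by fun_prop, ?_⟩
  rw [(indepFun_iff_map_prod_eq_prod_map_map (measurable_pi_iff.2 hXm').aemeasurable
    (measurable_pi_iff.2 hTm').aemeasurable).1 hind, hT.map_eq,
    Measure.map_prod_map _ _ (by fun_prop) (by fun_prop)]
  rfl

theorem shareMeasure_apply {P : Measure Ω} {Z : ℝ≥0 → Ω → ℝ} (t : ℝ≥0) {B : Set Ω}
    (hB : MeasurableSet B) : shareMeasure P Z t B
      = ∫⁻ ω, ENNReal.ofReal (Real.exp (Z t ω)) * B.indicator 1 ω ∂P := by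
  rw [shareMeasure, withDensity_apply _ hB, ← lintegral_indicator hB]
  congr 1
  ext ω
  by_cases h : ω ∈ B <;> simp [h]

/-- If the exponential tilting of `X` up to any deterministic time has the law of `X'`, then the
exponential tilting of the time-changed process has the law of the time-changed `X'`. -/
theorem identDistrib_shareMeasure_timeChange {P : Measure Ω} {P' : Measure Ω'}
    [IsProbabilityMeasure P] [IsProbabilityMeasure P'] {X : ℝ≥0 → Ω → ℝ} {T : ℝ≥0 → Ω → ℝ≥0}
    {X' : ℝ≥0 → Ω' → ℝ} {T' : ℝ≥0 → Ω' → ℝ≥0} (hXm : ∀ t, Measurable (X t))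
    (hclock : IsRandomClock T)
    (hX : ∀ ω t, ContinuousWithinAt (fun s => X s ω) (Set.Ici t) t)
    (hind : IndepFun (fun ω t => X t ω) (fun ω t => T t ω) P)
    (hXm' : ∀ t, Measurable (X' t)) (hTm' : ∀ t, Measurable (T' t))
    (hX' : ∀ ω t, ContinuousWithinAt (fun s => X' s ω) (Set.Ici t) t)
    (hind' : IndepFun (fun ω t => X' t ω) (fun ω t => T' t ω) P')
    (hT : IdentDistrib (fun ω t => T' t ω) (fun ω t => T t ω) P' P) (t : ℝ≥0)
    (hXX' : ∀ (r : ℝ≥0) (s : Set.Iic t → ℝ≥0), (∀ i, s i ≤ r) →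
      IdentDistrib (fun ω i => X (s i) ω) (fun ω i => X' (s i) ω) (shareMeasure P X r) P') :
    IdentDistrib (fun ω (s : Set.Iic t) => (timeChange X T s ω, T s ω))
      (fun ω (s : Set.Iic t) => (timeChange X' T' s ω, T' s ω))
      (shareMeasure P (timeChange X T) t) P' := by
  have hTm := hclock.measurable
  have hZ := measurable_timeChange hXm hTm hX
  have hZ' := measurable_timeChange hXm' hTm' hX'
  -- By independence, X and T may be placed on separate factors of Ω × Ω, so that the clock can be
  -- frozen by Fubini.
  have hprod := identDistrib_timeChange_prod hTm hXm hTm hX hind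
    (.refl (measurable_pi_iff.2 hTm).aemeasurable)
  have hprod' := identDistrib_timeChange_prod hTm hXm' hTm' hX' hind' hT
  have hres : Measurable fun (v : ℝ≥0 → ℝ × ℝ≥0) (s : Set.Iic t) => v s := by fun_prop
  have hW : Measurable fun ω (s : Set.Iic t) => (timeChange X T s ω, T s ω) :=
    measurable_pi_iff.2 fun s => (hZ s).prodMk (hTm s)
  have hW' : Measurable fun ω (s : Set.Iic t) => (timeChange X' T' s ω, T' s ω) :=
    measurable_pi_iff.2 fun s => (hZ' s).prodMk (hTm' s)
  refine ⟨hW.aemeasurable, hW'.aemeasurable, Measure.ext fun B hB => ?_⟩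
  have hV : Measurable fun (ω : Ω × Ω) (s : ℝ≥0) => (X (T s ω.2) ω.1, T s ω.2) :=
    measurable_pi_iff.2 fun s => (measurable_timeChange (X := fun t (ω : Ω × Ω) => X t ω.1)
      (T := fun t (ω : Ω × Ω) => T t ω.2) (by fun_prop) (by fun_prop) (fun ω => hX ω.1) s).prodMk
      (by fun_prop)
  have hV' : Measurable fun (ω : Ω' × Ω) (s : Set.Iic t) => (X' (T s ω.2) ω.1, T s ω.2) :=
    measurable_pi_iff.2 fun s => (measurable_timeChange (X := fun t (ω : Ω' × Ω) => X' t ω.1)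
      (T := fun t (ω : Ω' × Ω) => T t ω.2) (by fun_prop) (by fun_prop) (fun ω => hX' ω.1) s).prodMk
      (by fun_prop)
  let g : (ℝ≥0 → ℝ × ℝ≥0) → ℝ≥0∞ := fun v => ENNReal.ofReal (Real.exp (v t).1)
    * B.indicator 1 (fun s : Set.Iic t => v s)
  have hg : Measurable g := by
    refine Measurable.mul (by fun_prop) ?_
    exact (measurable_one.indicator hB).comp hres
  rw [Measure.map_apply hW hB, Measure.map_apply hW' hB, shareMeasure_apply t (hW hB)]
  calc _ = ∫⁻ ω, g (fun s => (timeChange X T s ω, T s ω)) ∂P := rfl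
    _ = ∫⁻ ω, g (fun s => (X (T s ω.2) ω.1, T s ω.2)) ∂(P.prod P) :=
        (hprod.comp hg).lintegral_eq
    _ = ∫⁻ ω₂, ∫⁻ ω₁, g (fun s => (X (T s ω₂) ω₁, T s ω₂)) ∂P ∂P :=
        lintegral_prod_symm _ (hg.comp hV).aemeasurable
    _ = ∫⁻ ω₂, P' {ω₁ | (fun s : Set.Iic t => (X' (T s ω₂) ω₁, T s ω₂)) ∈ B} ∂P := by
        refine lintegral_congr fun ω₂ => ?_
        have hA : Measurable fun (x : Set.Iic t → ℝ) (s : Set.Iic t) => (x s, T s ω₂) := by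
          fun_prop
        -- With the clock frozen, the tilt is at the deterministic horizon r = T_t(ω₂), and
        -- monotonicity of the clock keeps all T_s below r.
        have h1 := ((hXX' (T t ω₂) (fun s => T s ω₂) fun s => hclock.mono ω₂ s.2).comp
          hA).measure_mem_eq hB
        refine Eq.trans ?_ h1
        rw [shareMeasure_apply _ (hB.preimage (hA.comp (by fun_prop)))]
        rfl
    _ = (P'.prod P) {ω | (fun s : Set.Iic t => (X' (T s ω.2) ω.1, T s ω.2)) ∈ B} :=
        (Measure.prod_apply_symm (hV' hB)).symm
    _ = _ := ((hprod'.comp hres).measure_mem_eq hB).symm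

end TimeChange

/-! ### Events up to time t, null sets, and the call price. -/

section ShareMeasure

theorem sigmaUpTo_le_comap {Ω : Type*} (Z : ℝ≥0 → Ω → ℝ) (T : ℝ≥0 → Ω → ℝ≥0) (t : ℝ≥0) :
    sigmaUpTo Z T t
      ≤ MeasurableSpace.comap (fun ω (s : Set.Iic t) => (Z s ω, T s ω)) inferInstance := by
  refine iSup_le fun s => sup_le ?_ ?_
  · have h : Measurable fun x : Set.Iic t → ℝ × ℝ≥0 => (x s).1 := by fun_prop
    exact (h.comp (comap_measurable fun ω (s : Set.Iic t) => (Z s ω, T s ω))).comap_le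
  · have h : Measurable fun x : Set.Iic t → ℝ × ℝ≥0 => (x s).2 := by fun_prop
    exact (h.comp (comap_measurable fun ω (s : Set.Iic t) => (Z s ω, T s ω))).comap_le

theorem measurable_sigmaUpTo {Ω : Type*} (Z : ℝ≥0 → Ω → ℝ) (T : ℝ≥0 → Ω → ℝ≥0) {s t : ℝ≥0}
    (hst : s ≤ t) : Measurable[sigmaUpTo Z T t] fun ω => (Z s ω, T s ω) := by
  have h : MeasurableSpace.comap (Z s) inferInstance ⊔ MeasurableSpace.comap (T s) inferInstance
      ≤ sigmaUpTo Z T t :=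
    le_iSup (fun s : Set.Iic t => MeasurableSpace.comap (Z s) inferInstance ⊔
      MeasurableSpace.comap (T s) inferInstance) ⟨s, hst⟩
  have h1 : Measurable[sigmaUpTo Z T t] (Z s) :=
    measurable_iff_comap_le.2 (le_sup_left.trans h)
  have h2 : Measurable[sigmaUpTo Z T t] (T s) :=
    measurable_iff_comap_le.2 (le_sup_right.trans h)
  exact h1.prodMk h2

theorem measurableSet_restrict_mem_sigmaUpTo {Ω : Type*} (Z : ℝ≥0 → Ω → ℝ) (T : ℝ≥0 → Ω → ℝ≥0)
    {t : ℝ≥0} {I : Finset ℝ≥0} (hI : ∀ s ∈ I, s ≤ t) {C : Set (I → ℝ × ℝ≥0)}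
    (hC : MeasurableSet C) :
    MeasurableSet[sigmaUpTo Z T t] {ω | I.restrict (fun s => (Z s ω, T s ω)) ∈ C} := by
  have h : Measurable[sigmaUpTo Z T t] fun ω => I.restrict fun s => (Z s ω, T s ω) := by
    let _ := sigmaUpTo Z T t
    exact measurable_pi_iff.2 fun s => measurable_sigmaUpTo Z T (hI s s.2)
  exact h hC

/-- Stated through events so that it applies to a measure on another σ-algebra whose values are
prescribed only on cylinder events. Finiteness of Q is not assumed: I = ∅ gives total mass 1. -/
theorem identDistrib_of_forall_finset_measure_eq {Ω Ω' ι E : Type*} [MeasurableSpace Ω]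
    [MeasurableSpace Ω'] [MeasurableSpace E] {Q : Measure Ω} {P' : Measure Ω'}
    [IsProbabilityMeasure P'] {Y : Ω → ι → E} {Y' : Ω' → ι → E} (hY : ∀ i, Measurable fun ω => Y ω i)
    (hY' : ∀ i, Measurable fun ω => Y' ω i)
    (h : ∀ (I : Finset ι) (C : Set (I → E)), MeasurableSet C →
      Q {ω | I.restrict (Y ω) ∈ C} = P' {ω | I.restrict (Y' ω) ∈ C}) :
    IdentDistrib Y Y' Q P' := by
  have hQ : IsProbabilityMeasure Q := ⟨by
    have := h ∅ Set.univ MeasurableSet.univ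
    simpa only [Set.mem_univ, Set.ofPred_true, measure_univ] using this⟩
  have hYm : Measurable Y := measurable_pi_iff.2 hY
  have hYm' : Measurable Y' := measurable_pi_iff.2 hY'
  refine identDistrib_of_forall_finset_map_eq hYm hYm' fun I => Measure.ext fun C hC => ?_
  have hI : Measurable fun ω => I.restrict (Y ω) := (Finset.measurable_restrict I).comp hYm
  have hI' : Measurable fun ω => I.restrict (Y' ω) := (Finset.measurable_restrict I).comp hYm'
  rw [Measure.map_apply hI hC, Measure.map_apply hI' hC]
  exact h I C hC

variable {Ω : Type*} [mΩ : MeasurableSpace Ω] {P : Measure Ω}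

/-- Every event of the enlarged σ-algebra differs from one in `sigmaUpTo Z T s` by a P-null set,
which the tilted measures do not charge. -/
theorem shareMeasure_eq_of_eq_sigmaUpTo {Z : ℝ≥0 → Ω → ℝ} {T : ℝ≥0 → Ω → ℝ≥0} {s t : ℝ≥0}
    (h : ∀ B, MeasurableSet[sigmaUpTo Z T s] B → shareMeasure P Z t B = shareMeasure P Z s B)
    {B : Set Ω} (hB : MeasurableSet[sigmaUpTo Z T s ⊔ nullSigma P] B) :
    shareMeasure P Z t B = shareMeasure P Z s B := by
  have hle : sigmaUpTo Z T s ⊔ nullSigma P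
      ≤ eventuallyMeasurableSpace (sigmaUpTo Z T s) (ae P) := by
    refine sup_le (le_eventuallyMeasurableSpace) (MeasurableSpace.generateFrom_le ?_)
    rintro N ⟨-, hN⟩
    exact ⟨∅, @MeasurableSet.empty _ (sigmaUpTo Z T s), ae_eq_empty.2 hN⟩
  obtain ⟨B', hB', hBB'⟩ := hle B hB
  have hac (r : ℝ≥0) : shareMeasure P Z r B = shareMeasure P Z r B' :=
    measure_congr ((withDensity_absolutelyContinuous P _).ae_eq hBB')
  rw [hac, hac, h B' hB']

theorem integrable_exp_of_isProbabilityMeasure_shareMeasure {Z : ℝ≥0 → Ω → ℝ}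
    (hZ : ∀ t, Measurable (Z t)) {t : ℝ≥0} (h : IsProbabilityMeasure (shareMeasure P Z t)) :
    Integrable (fun ω => Real.exp (Z t ω)) P := by
  refine ⟨(Real.measurable_exp.comp (hZ t)).aestronglyMeasurable, ?_⟩
  rw [hasFiniteIntegral_iff_ofReal (ae_of_all _ fun ω => (Real.exp_pos _).le)]
  have h1 := h.measure_univ
  rw [shareMeasure, withDensity_apply _ MeasurableSet.univ, Measure.restrict_univ] at h1
  rw [h1]
  exact ENNReal.one_lt_top

variable [IsProbabilityMeasure P]

/-- The payoff is (S₀ e^{Z_t} - K) on the exercise event {Z_t ≥ k} and 0 elsewhere; the integral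
splits there, and S₀ e^k = K. -/
theorem integral_call_eq {Z : ℝ≥0 → Ω → ℝ} (hZ : ∀ t, Measurable (Z t)) (t : ℝ≥0)
    (hint : Integrable (fun ω => Real.exp (Z t ω)) P) {S₀ K : ℝ} (hS : 0 < S₀) (hK : 0 < K) :
    Integrable (fun ω => max (S₀ * Real.exp (Z t ω) - K) 0) P ∧
      ∫ ω, max (S₀ * Real.exp (Z t ω) - K) 0 ∂P =
        S₀ * (shareMeasure P Z t).real {ω | Real.log (K / S₀) ≤ Z t ω}
          - S₀ * Real.exp (Real.log (K / S₀)) * P.real {ω | Real.log (K / S₀) ≤ Z t ω} := by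
  have hi : Integrable (fun ω => S₀ * Real.exp (Z t ω) - K) P :=
    (hint.const_mul S₀).sub (integrable_const K)
  refine ⟨hi.pos_part, ?_⟩
  set A := {ω | Real.log (K / S₀) ≤ Z t ω} with hA
  have hAm : MeasurableSet A := measurableSet_le measurable_const (hZ t)
  have hmem (ω : Ω) : ω ∈ A ↔ K ≤ S₀ * Real.exp (Z t ω) := by
    rw [hA, Set.mem_ofPred_eq, Real.log_le_iff_le_exp (by positivity), div_le_iff₀ hS, mul_comm]
  have hmax : (fun ω => max (S₀ * Real.exp (Z t ω) - K) 0)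
      = A.indicator fun ω => S₀ * Real.exp (Z t ω) - K := by
    ext ω
    by_cases h : ω ∈ A
    · rw [Set.indicator_of_mem h, max_eq_left (sub_nonneg.2 ((hmem ω).1 h))]
    · rw [Set.indicator_of_notMem h]
      rw [hmem, not_le] at h
      exact max_eq_right (by linarith)
  have hshare : (shareMeasure P Z t).real A = ∫ ω in A, Real.exp (Z t ω) ∂P := by
    rw [Measure.real, shareMeasure, withDensity_apply _ hAm,
      ← ofReal_integral_eq_lintegral_ofReal hint.integrableOn
        (ae_of_all _ fun ω => (Real.exp_pos _).le),
      ENNReal.toReal_ofReal (integral_nonneg fun ω => (Real.exp_pos _).le)]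
  rw [hmax, integral_indicator hAm, integral_sub (hint.const_mul S₀).integrableOn
    (integrable_const K).integrableOn, integral_const_mul, hshare, setIntegral_const,
    Real.exp_log (by positivity), mul_div_cancel₀ _ hS.ne', smul_eq_mul, mul_comm K]

end ShareMeasure

/-! ### The tilted law under the hypotheses of the theorem. -/

section TiltedLaw

variable {Ω Ω' : Type*} [MeasurableSpace Ω] [MeasurableSpace Ω'] {P : Measure Ω}
  [IsProbabilityMeasure P] {X : ℝ≥0 → Ω → ℝ} {b σ : ℝ} {ν : ℝ → ℝ}

theorem isLevyMeasure_tiltedDensity (hν : Measurable ν) (hpos : ∀ x, x ≠ 0 → 0 < ν x)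
    (hlevy : IsLevyMeasure (densityMeasure ν))
    (hexp : IntegrableOn (fun x => Real.exp x * ν x) {x | 1 < |x|}) :
    IsLevyMeasure (densityMeasure (tiltedDensity ν)) := by
  rw [densityMeasure_tiltedDensity hν]
  exact hlevy.withDensity_exp (integrableOn_exp_densityMeasure hν hpos hexp)

theorem IsLevyProcessWithTriplet.hasLevyIncrements_tilted
    (hX : IsLevyProcessWithTriplet X P b (σ ^ 2) (densityMeasure ν)) (hν : Measurable ν)
    (hpos : ∀ x, x ≠ 0 → 0 < ν x)
    (hexp : IntegrableOn (fun x => Real.exp x * ν x) {x | 1 < |x|})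
    (hmart : b + σ ^ 2 / 2 + ∫ x, (Real.exp x - 1 - smallJump x) * ν x = 0) (r : ℝ≥0) :
    HasLevyIncrements X (shareMeasure P X r) r
      (levyExponent (tiltedDrift b σ ν) (σ ^ 2) (densityMeasure (tiltedDensity ν))) :=
  hX.hasLevyIncrements_shareMeasure (integrableOn_exp_densityMeasure hν hpos hexp)
    (levyExponent_zero _ _ _)
    (levyLaplace_densityMeasure_one_add hν hpos hX.levyMeasure hexp hmart) r

theorem IsLevyWithIndepClock.identDistrib_shareMeasure {T : ℝ≥0 → Ω → ℝ≥0}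
    (hXT : IsLevyWithIndepClock X T P b (σ ^ 2) (densityMeasure ν)) (hν : Measurable ν)
    (hpos : ∀ x, x ≠ 0 → 0 < ν x)
    (hexp : IntegrableOn (fun x => Real.exp x * ν x) {x | 1 < |x|})
    (hmart : b + σ ^ 2 / 2 + ∫ x, (Real.exp x - 1 - smallJump x) * ν x = 0)
    {P' : Measure Ω'} [IsProbabilityMeasure P'] {X' : ℝ≥0 → Ω' → ℝ} {T' : ℝ≥0 → Ω' → ℝ≥0}
    (hXT' : IsLevyWithIndepClock X' T' P' (tiltedDrift b σ ν) (σ ^ 2)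
      (densityMeasure (tiltedDensity ν)))
    (hT : IdentDistrib (fun ω t => T' t ω) (fun ω t => T t ω) P' P) (t : ℝ≥0) :
    IdentDistrib (fun ω (s : Set.Iic t) => (timeChange X T s ω, T s ω))
      (fun ω (s : Set.Iic t) => (timeChange X' T' s ω, T' s ω))
      (shareMeasure P (timeChange X T) t) P' := by
  have hL := hXT.levy.levy
  have hL' := hXT'.levy.levy
  refine identDistrib_shareMeasure_timeChange hL.measurable hXT.clock hL.rightCont hXT.indep
    hL'.measurable hXT'.clock.measurable hL'.rightCont hXT'.indep hT t fun r s hs => ?_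
  exact (hXT.levy.hasLevyIncrements_tilted hν hpos hexp hmart r).identDistrib
    (hXT'.levy.hasLevyIncrements r) hL.measurable hL'.measurable
    ((withDensity_absolutelyContinuous P _).ae_le hL.zero) hL'.zero hs

end TiltedLaw

theorem mainTheorem5
    {Ω : Type u} [mΩ : MeasurableSpace Ω] (P : Measure Ω) [IsProbabilityMeasure P]
    (X : ℝ≥0 → Ω → ℝ) (T : ℝ≥0 → Ω → ℝ≥0) (b σ : ℝ) (ν : ℝ → ℝ)
    -- `X` is a Lévy process with triplet `(b, σ², ν(x)dx)`, and `T` is an independent random clock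
    (hXT : IsLevyWithIndepClock X T P b (σ ^ 2) (densityMeasure ν))
    -- regularity of the Lévy density
    (hν_pos : ∀ x, x ≠ 0 → 0 < ν x)
    (hν_smooth : ContDiffOn ℝ 1 ν {0}ᶜ)
    (hν_bdd : ∀ ε > 0, ∃ C, ∀ x, ε < |x| → ν x ≤ C)
    -- exponential moment conditions
    (hν_exp : IntegrableOn (fun x => Real.exp x * ν x) {x | 1 < |x|})
    (hν_exp_bdd : ∀ ε > 0, ∃ C, ∀ x, ε < |x| → Real.exp x * ν x ≤ C)
    -- the martingale condition
    (hmart : b + σ ^ 2 / 2 + ∫ x, (Real.exp x - 1 - smallJump x) * ν x = 0) :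
    -- `P̃` is a well-defined probability measure on the events up to any time
    (∀ t, Measurable (timeChange X T t)) ∧
    (∀ t, IsProbabilityMeasure (shareMeasure P (timeChange X T) t)) ∧
    (∀ s t, s ≤ t → ∀ B, MeasurableSet[sigmaUpTo (timeChange X T) T s ⊔ nullSigma P] B →
      shareMeasure P (timeChange X T) t B = shareMeasure P (timeChange X T) s B) ∧
    -- a Lévy process with the tilted triplet and an independent copy of the clock exist
    (∃ (Ω' : Type u) (_ : MeasurableSpace Ω') (P' : Measure Ω')
      (X' : ℝ≥0 → Ω' → ℝ) (T' : ℝ≥0 → Ω' → ℝ≥0), IsProbabilityMeasure P' ∧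
      IsLevyWithIndepClock X' T' P' (tiltedDrift b σ ν) (σ ^ 2)
        (densityMeasure (tiltedDensity ν)) ∧
      IdentDistrib (fun ω t => T' t ω) (fun ω t => T t ω) P' P) ∧
    -- under `P̃`, `(Z, T)` has the law of any such Lévy process evaluated at its clock
    (∀ (Ω' : Type v) [MeasurableSpace Ω'] (P' : Measure Ω') [IsProbabilityMeasure P']
      (X' : ℝ≥0 → Ω' → ℝ) (T' : ℝ≥0 → Ω' → ℝ≥0),
      IsLevyWithIndepClock X' T' P' (tiltedDrift b σ ν) (σ ^ 2)
        (densityMeasure (tiltedDensity ν)) →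
      IdentDistrib (fun ω t => T' t ω) (fun ω t => T t ω) P' P →
      -- on every finite horizon
      (∀ t : ℝ≥0, IdentDistrib
        (fun ω (s : Set.Iic t) => (timeChange X T s ω, T s ω))
        (fun ω (s : Set.Iic t) => (timeChange X' T' s ω, T' s ω))
        (shareMeasure P (timeChange X T) t) P') ∧
      -- and on the infinite horizon, for every measure `Q` that extends all of them
      (∀ (m : MeasurableSpace Ω), (∀ t, sigmaUpTo (timeChange X T) T t ≤ m) →
        ∀ Q : @Measure Ω m,
        (∀ t > 0, ∀ B, MeasurableSet[sigmaUpTo (timeChange X T) T t] B →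
          Q B = @shareMeasure Ω mΩ P (timeChange X T) t B) →
        @IdentDistrib _ _ _ m _ _
          (fun ω (s : ℝ≥0) => (timeChange X T s ω, T s ω))
          (fun ω (s : ℝ≥0) => (timeChange X' T' s ω, T' s ω)) Q P')) ∧
    -- the call price representation
    (∀ S₀ K : ℝ, 0 < S₀ → 0 < K → ∀ t : ℝ≥0,
      Integrable (fun ω => max (S₀ * Real.exp (timeChange X T t ω) - K) 0) P ∧
      ∫ ω, max (S₀ * Real.exp (timeChange X T t ω) - K) 0 ∂P =
        S₀ * (shareMeasure P (timeChange X T) t).real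
            {ω | Real.log (K / S₀) ≤ timeChange X T t ω}
          - S₀ * Real.exp (Real.log (K / S₀)) *
            P.real {ω | Real.log (K / S₀) ≤ timeChange X T t ω}) := by
  have hνm : Measurable ν := measurable_of_continuousOn_compl_singleton 0 hν_smooth.continuousOn
  have hL := hXT.levy.levy
  have hTm := hXT.clock.measurable
  have hZ := measurable_timeChange hL.measurable hTm hL.rightCont
  have hex := exists_isLevyWithIndepClock (P := P) hL.measurable hL.rightCont hL.leftLim hXT.clock
    (sq_nonneg σ) (isLevyMeasure_tiltedDensity hνm hν_pos hXT.levy.levyMeasure hν_exp)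
    (hXT.levy.hasLevyIncrements_tilted hνm hν_pos hν_exp hmart 1)
  obtain ⟨Ω₁, _, P₁, X₁, T₁, hP₁, hXT₁, hT₁⟩ := hex
  have hlaw := hXT.identDistrib_shareMeasure hνm hν_pos hν_exp hmart hXT₁ hT₁
  -- Total mass one is read off from the identity of laws with a process under the probability
  -- measure `P₁`.
  have hprob (t : ℝ≥0) : IsProbabilityMeasure (shareMeasure P (timeChange X T) t) := by
    have := (hlaw t).measure_mem_eq MeasurableSet.univ
    simp only [Set.preimage_univ, measure_univ] at this
    exact ⟨this⟩
  refine ⟨hZ, hprob, fun s t hst B hB => shareMeasure_eq_of_eq_sigmaUpTo (fun B hB => ?_) hB,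
    ⟨Ω₁, _, P₁, X₁, T₁, hP₁, hXT₁, hT₁⟩, fun Ω' _ P' _ X' T' hXT' hT' => ⟨?_, ?_⟩,
    fun S₀ K hS hK t => integral_call_eq hZ t
      (integrable_exp_of_isProbabilityMeasure_shareMeasure hZ (hprob t)) hS hK⟩
  -- Both horizons assign B the same probability, that of the corresponding event for the reference
  -- process under `P₁`.
  · obtain ⟨C, hC, rfl⟩ := sigmaUpTo_le_comap _ _ _ B hB
    have hres : Measurable fun (x : Set.Iic t → ℝ × ℝ≥0) (i : Set.Iic s) =>
        x ⟨i, i.2.trans hst⟩ := by fun_prop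
    exact (((hlaw t).comp hres).measure_mem_eq hC).trans ((hlaw s).measure_mem_eq hC).symm
  · exact hXT.identDistrib_shareMeasure hνm hν_pos hν_exp hmart hXT' hT'
  · have hZ' := measurable_timeChange hXT'.levy.levy.measurable hXT'.clock.measurable
      hXT'.levy.levy.rightCont
    have hfin (I : Finset ℝ≥0) (C : Set (I → ℝ × ℝ≥0)) (hC : MeasurableSet C) : ∃ t : ℝ≥0, 0 < t ∧
        MeasurableSet[sigmaUpTo (timeChange X T) T t]
          {ω | I.restrict (fun s => (timeChange X T s ω, T s ω)) ∈ C} ∧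
        shareMeasure P (timeChange X T) t
            {ω | I.restrict (fun s => (timeChange X T s ω, T s ω)) ∈ C}
          = P' {ω | I.restrict (fun s => (timeChange X' T' s ω, T' s ω)) ∈ C} := by
      -- The +1 makes the horizon positive even when I is empty or {0}, since Q is prescribed only
      -- for t > 0.
      obtain ⟨t, ht0, hIt⟩ : ∃ t : ℝ≥0, 0 < t ∧ ∀ s ∈ I, s ≤ t :=
        ⟨I.sup id + 1, by positivity, fun s hs => (Finset.le_sup (f := id) hs).trans le_self_add⟩
      have hres : Measurable fun (x : Set.Iic t → ℝ × ℝ≥0) (i : I) => x ⟨i, hIt i i.2⟩ := by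
        fun_prop
      exact ⟨t, ht0, measurableSet_restrict_mem_sigmaUpTo _ _ hIt hC,
        ((hXT.identDistrib_shareMeasure hνm hν_pos hν_exp hmart hXT' hT' t).comp
          hres).measure_mem_eq hC⟩
    intro m hm Q hQ
    refine @identDistrib_of_forall_finset_measure_eq Ω Ω' ℝ≥0 (ℝ × ℝ≥0) m _ _ Q P' _ _ _
      (fun s => (measurable_sigmaUpTo (timeChange X T) T le_rfl).mono (hm s) le_rfl)
      (fun s => (hZ' s).prodMk (hXT'.clock.measurable s)) fun I C hC => ?_
    obtain ⟨t, ht0, hmeas, heq⟩ := hfin I C hC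
    exact (hQ t ht0 _ hmeas).trans heq
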